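/- **Theorem 5.1.** For finite sets $A,B\subset\mathbb R$ with $A\neq\emptyset$, let $N_A(x)$ denote a nearest neighbour of $x$ in $A$ (ties broken arbitrarily), let $h(B,A)=\sum_{b\in B}(b-N_A(b))^2$ be the unidirectional (Hausdorff) RMS distance from $B$ to $A$, and let $r(t)=h(B+t,A)$, $t\in\mathbb R$, be this distance under translation of $B$, where $B+t=\{b+t: b\in B\}$. Write $\lg x=\max\{1,\log_2 x\}$ (with $\lg 0=1$). There are a program for the real RAM and a constant $C$ such that the following holds for all $n\ge 1$ and $m\ge 0$. Given $n$, $m$, an array holding the elements $a_1<a_2<\dots<a_n$ of a set $A\subset\mathbb R$ in increasing order, and an array holding the $m$ distinct elements of a set $B\subset\mathbb R$ in arbitrary order, the program halts after at most $$C\cdot\min\bigl\{\,n+m\lg^2 n\,\lg m,\;\; n\lg n+m\lg n\,\lg(\min\{n,m\})\,\bigr\}$$ elementary steps, and outputs a local minimum $t^*$ of $r$ together with the value $r(t^*)$. Here the real RAM has registers and arrays of natural numbers and of real numbers, and the following count as one elementary step each: addition, truncated subtraction and halving (rounded down) of natural numbers, the four arithmetic operations on reals (with $x/0=0$), conversion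 of a natural number to a real, comparisons and their Boolean combinations, rational constants, assignments, array accesses at a computed index, branches and procedure calls. There is no rounding operation from reals to natural numbers. -/

import Mathlib

/-! ### The Hausdorff RMS distance -/

section RMS

variable {E : Type*} [NormedAddCommGroup E]

open Classical in
/-- A nearest neighbour `N_A(x)` of `x` in the finite set `A`, ties being broken arbitrarily
(the value is irrelevant when `A` is empty). -/
noncomputable def nearestNeighbor (A : Finset E) (x : E) : E :=
  if h : A.Nonempty then (A.exists_min_image (fun a => ‖x - a‖) h).choose else 0

theorem nearestNeighbor_mem {A : Finset E} (h : A.Nonempty) (x : E) :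
    nearestNeighbor A x ∈ A := by
  rw [nearestNeighbor, dif_pos h]
  exact (A.exists_min_image (fun a => ‖x - a‖) h).choose_spec.1

theorem norm_sub_nearestNeighbor_le {A : Finset E} (x : E) {a : E} (ha : a ∈ A) :
    ‖x - nearestNeighbor A x‖ ≤ ‖x - a‖ := by
  have h : A.Nonempty := ⟨a, ha⟩
  rw [nearestNeighbor, dif_pos h]
  exact (A.exists_min_image (fun a => ‖x - a‖) h).choose_spec.2 a ha

/-- The unidirectional (Hausdorff) RMS distance `h(B, A) = ∑_{b ∈ B} ‖b - N_A(b)‖²`. -/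
noncomputable def hausdorffRMS (B A : Finset E) : ℝ :=
  ∑ b ∈ B, ‖b - nearestNeighbor A b‖ ^ 2

/-- The translated set `B + t`. -/
def translateBy (B : Finset E) (t : E) : Finset E :=
  B.map (addRightEmbedding t)

/-- The unidirectional RMS distance from `B` to `A` as a function of the translation `t` of `B`,
`r(t) = h(B + t, A)`. -/
noncomputable def rmsUnderTranslation (B A : Finset E) (t : E) : ℝ :=
  hausdorffRMS (translateBy B t) A

end RMS

/-! ### The real RAM

Programs of a real RAM with unit-cost operations, written as structured code. Natural numbers
(used for counting and for addressing) and reals are kept in separate registers and arrays.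
The operations are: `+`, truncated `-` and halving on naturals; `+`, `-`, `*`, `/` on reals;
the inclusion of the naturals in the reals; comparisons; and array access at a computed index.
There is no operation, such as rounding, that turns a real into a natural number. -/

namespace RealRAM

/-- The contents of the memory: natural-number registers, real registers, natural-number arrays
and real arrays. A register or an array is named by a natural number that is fixed in the
program text; only the index into an array can be computed at run time. -/
structure Store where
  natReg : ℕ → ℕ
  realReg : ℕ → ℝ
  natArr : ℕ → ℕ → ℕ
  realArr : ℕ → ℕ → ℝ

/-- Natural-number expressions; `read k i` is the entry of index `i` of the array `k`. -/
inductive NatExpr where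
  | const (c : ℕ)
  | reg (x : ℕ)
  | read (k : ℕ) (i : NatExpr)
  | add (e f : NatExpr)
  | sub (e f : NatExpr)
  | half (e : NatExpr)

/-- Real expressions; the only constants are rational numbers. -/
inductive RealExpr where
  | const (q : ℚ)
  | reg (x : ℕ)
  | read (k : ℕ) (i : NatExpr)
  | ofNat (e : NatExpr)
  | add (e f : RealExpr)
  | sub (e f : RealExpr)
  | mul (e f : RealExpr)
  | div (e f : RealExpr)

/-- Tests. -/
inductive Test where
  | natLt (e f : NatExpr)
  | natEq (e f : NatExpr)
  | realLt (e f : RealExpr)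
  | realEq (e f : RealExpr)
  | not (p : Test)
  | and (p q : Test)
  | or (p q : Test)

/-- Commands. `setNat x e` and `setReal x e` assign to a register, `writeNat k i e` and
`writeReal k i e` to the entry of index `i` of the array `k`, and `call p` runs the procedure
number `p` (procedures may be recursive, and all registers are global). -/
inductive Cmd where
  | skip
  | setNat (x : ℕ) (e : NatExpr)
  | setReal (x : ℕ) (e : RealExpr)
  | writeNat (k : ℕ) (i e : NatExpr)
  | writeReal (k : ℕ) (i : NatExpr) (e : RealExpr)
  | seq (c d : Cmd)
  | ite (p : Test) (c d : Cmd)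
  | while (p : Test) (c : Cmd)
  | call (p : ℕ)

/-- A program: a finite list of procedures and a main command. -/
structure Program where
  procs : List Cmd
  main : Cmd

/-- The value of a natural-number expression. -/
def NatExpr.eval (s : Store) : NatExpr → ℕ
  | .const c => c
  | .reg x => s.natReg x
  | .read k i => s.natArr k (i.eval s)
  | .add e f => e.eval s + f.eval s
  | .sub e f => e.eval s - f.eval s
  | .half e => e.eval s / 2

/-- The number of elementary operations in the evaluation of a natural-number expression. -/
def NatExpr.cost : NatExpr → ℕ
  | .const _ => 1
  | .reg _ => 1
  | .read _ i => i.cost + 1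
  | .add e f => e.cost + f.cost + 1
  | .sub e f => e.cost + f.cost + 1
  | .half e => e.cost + 1

/-- The value of a real expression (a quotient by zero has the value zero). -/
noncomputable def RealExpr.eval (s : Store) : RealExpr → ℝ
  | .const q => (q : ℝ)
  | .reg x => s.realReg x
  | .read k i => s.realArr k (i.eval s)
  | .ofNat e => (e.eval s : ℝ)
  | .add e f => e.eval s + f.eval s
  | .sub e f => e.eval s - f.eval s
  | .mul e f => e.eval s * f.eval s
  | .div e f => e.eval s / f.eval s

/-- The number of elementary operations in the evaluation of a real expression. -/
def RealExpr.cost : RealExpr → ℕ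
  | .const _ => 1
  | .reg _ => 1
  | .read _ i => i.cost + 1
  | .ofNat e => e.cost + 1
  | .add e f => e.cost + f.cost + 1
  | .sub e f => e.cost + f.cost + 1
  | .mul e f => e.cost + f.cost + 1
  | .div e f => e.cost + f.cost + 1

/-- The truth value of a test. -/
def Test.Holds (s : Store) : Test → Prop
  | .natLt e f => e.eval s < f.eval s
  | .natEq e f => e.eval s = f.eval s
  | .realLt e f => e.eval s < f.eval s
  | .realEq e f => e.eval s = f.eval s
  | .not p => ¬ p.Holds s
  | .and p q => p.Holds s ∧ q.Holds s
  | .or p q => p.Holds s ∨ q.Holds s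

/-- The number of elementary operations in the evaluation of a test. -/
def Test.cost : Test → ℕ
  | .natLt e f => e.cost + f.cost + 1
  | .natEq e f => e.cost + f.cost + 1
  | .realLt e f => e.cost + f.cost + 1
  | .realEq e f => e.cost + f.cost + 1
  | .not p => p.cost + 1
  | .and p q => p.cost + q.cost + 1
  | .or p q => p.cost + q.cost + 1

/-- Change one natural-number register. -/
def Store.setNat (s : Store) (x : ℕ) (v : ℕ) : Store :=
  { s with natReg := Function.update s.natReg x v }

/-- Change one real register. -/
def Store.setReal (s : Store) (x : ℕ) (v : ℝ) : Store :=
  { s with realReg := Function.update s.realReg x v }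

/-- Change one entry of a natural-number array. -/
def Store.writeNat (s : Store) (k i : ℕ) (v : ℕ) : Store :=
  { s with natArr := Function.update s.natArr k (Function.update (s.natArr k) i v) }

/-- Change one entry of a real array. -/
def Store.writeReal (s : Store) (k i : ℕ) (v : ℝ) : Store :=
  { s with realArr := Function.update s.realArr k (Function.update (s.realArr k) i v) }

/-- `Exec procs c s T s'`: with the procedures `procs`, the command `c` started on the store `s`
terminates after exactly `T` elementary steps, on the store `s'`. -/
inductive Exec (procs : List Cmd) : Cmd → Store → ℕ → Store → Prop where
  | skip (s : Store) : Exec procs .skip s 1 s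
  | setNat (s : Store) (x : ℕ) (e : NatExpr) :
      Exec procs (.setNat x e) s (e.cost + 1) (s.setNat x (e.eval s))
  | setReal (s : Store) (x : ℕ) (e : RealExpr) :
      Exec procs (.setReal x e) s (e.cost + 1) (s.setReal x (e.eval s))
  | writeNat (s : Store) (k : ℕ) (i e : NatExpr) :
      Exec procs (.writeNat k i e) s (i.cost + e.cost + 1) (s.writeNat k (i.eval s) (e.eval s))
  | writeReal (s : Store) (k : ℕ) (i : NatExpr) (e : RealExpr) :
      Exec procs (.writeReal k i e) s (i.cost + e.cost + 1) (s.writeReal k (i.eval s) (e.eval s))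
  | seq {c d : Cmd} {s s₁ s₂ : Store} {T₁ T₂ : ℕ} :
      Exec procs c s T₁ s₁ → Exec procs d s₁ T₂ s₂ → Exec procs (.seq c d) s (T₁ + T₂) s₂
  | ite_true {p : Test} {c d : Cmd} {s s' : Store} {T : ℕ} :
      p.Holds s → Exec procs c s T s' → Exec procs (.ite p c d) s (p.cost + 1 + T) s'
  | ite_false {p : Test} {c d : Cmd} {s s' : Store} {T : ℕ} :
      ¬ p.Holds s → Exec procs d s T s' → Exec procs (.ite p c d) s (p.cost + 1 + T) s'
  | while_true {p : Test} {c : Cmd} {s s₁ s₂ : Store} {T₁ T₂ : ℕ} :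
      p.Holds s → Exec procs c s T₁ s₁ → Exec procs (.while p c) s₁ T₂ s₂ →
        Exec procs (.while p c) s (p.cost + 1 + T₁ + T₂) s₂
  | while_false {p : Test} {c : Cmd} {s : Store} :
      ¬ p.Holds s → Exec procs (.while p c) s (p.cost + 1) s
  | call {p : ℕ} {s s' : Store} {T : ℕ} :
      Exec procs (procs.getD p .skip) s T s' → Exec procs (.call p) s (T + 1) s'

/-- Runs are deterministic, so that a terminating run is the only one. -/
theorem Exec.deterministic {procs : List Cmd} {c : Cmd} {s s₁ s₂ : Store} {T₁ T₂ : ℕ}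
    (h₁ : Exec procs c s T₁ s₁) (h₂ : Exec procs c s T₂ s₂) : T₁ = T₂ ∧ s₁ = s₂ := by
  induction h₁ generalizing T₂ s₂ with
  | skip | setNat | setReal | writeNat | writeReal => cases h₂; exact ⟨rfl, rfl⟩
  | seq _ _ ih ih' =>
    cases h₂ with
    | seq k k' =>
      obtain ⟨rfl, rfl⟩ := ih k
      obtain ⟨rfl, rfl⟩ := ih' k'
      exact ⟨rfl, rfl⟩
  | ite_true hp _ ih =>
    cases h₂ with
    | ite_true _ k => obtain ⟨rfl, rfl⟩ := ih k; exact ⟨rfl, rfl⟩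
    | ite_false hn _ => exact absurd hp hn
  | ite_false hn _ ih =>
    cases h₂ with
    | ite_true hp _ => exact absurd hp hn
    | ite_false _ k => obtain ⟨rfl, rfl⟩ := ih k; exact ⟨rfl, rfl⟩
  | while_true hp _ _ ih ih' =>
    cases h₂ with
    | while_true _ k k' =>
      obtain ⟨rfl, rfl⟩ := ih k
      obtain ⟨rfl, rfl⟩ := ih' k'
      exact ⟨rfl, rfl⟩
    | while_false hn => exact absurd hp hn
  | while_false hn =>
    cases h₂ with
    | while_true hp _ _ => exact absurd hp hn
    | while_false _ => exact ⟨rfl, rfl⟩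
  | call _ ih =>
    cases h₂ with
    | call k => obtain ⟨rfl, rfl⟩ := ih k; exact ⟨rfl, rfl⟩

/-- The program `P` started on `s` halts after exactly `T` elementary steps, on the store `s'`. -/
def Program.Runs (P : Program) (s : Store) (T : ℕ) (s' : Store) : Prop :=
  Exec P.procs P.main s T s'

/-- The initial store on the input `(a, b)`: the lengths `n` and `m` are in the natural-number
registers `0` and `1`, the two sequences are in the real arrays `0` and `1` from index `0` on, and
everything else is zero. -/
noncomputable def input {n m : ℕ} (a : Fin n → ℝ) (b : Fin m → ℝ) : Store where
  natReg x := if x = 0 then n else if x = 1 then m else 0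
  realReg _ := 0
  natArr _ _ := 0
  realArr k i :=
    if k = 0 then (if h : i < n then a ⟨i, h⟩ else 0)
    else if k = 1 then (if h : i < m then b ⟨i, h⟩ else 0)
    else 0

end RealRAM

/-- The logarithm of a time bound: to base two, and replaced by `1` where it is smaller. -/
noncomputable def lg (x : ℕ) : ℝ := max 1 (Real.logb 2 x)

/-!
The program uses prune and search, and takes time `O(m lg² n)`, which meets both time bounds.

With ties going to the left, `halfSlope t = ∑ (b x + t - a (cell (b x + t)))` is half of the left
derivative of `r`. It is nonpositive far to the left and positive far to the right, and it only
jumps downwards, where a point `b x + t` passes the boundary of two Voronoi cells. Hence there is a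
local minimum between a translation `tl` with `halfSlope tl ≤ 0` and a translation `th > tl` with
`0 < halfSlope th`. For each point `b x` the program keeps a range `lo x, …, hi x` of cells which
contains the cell of `b x + t` for all `t` between `tl` and `th` (`Bracket`). Once all ranges are
singletons, `r` is a single quadratic function between `tl` and `th`, and its stationary point lies
there and is a local minimum of `r` (`Bracket.isLocalMin`).

A point with more than one cell in its range is active. The pivot of an active point is the
translation that takes it to the boundary in the middle of its range. In a round, a number `p` is
chosen that has at least one sixteenth of the pivots on either side. If `p` is between `tl` and
`th`, then the half slope at `p` is evaluated, with a binary search for each active point (the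
others contribute a linear function of `p`, whose coefficients are known), and `p` becomes the new
`tl` or `th`. In either case one sixteenth of the pivots are outside of the bracket, and the ranges
of their points can be halved (`wp_round`). Each point admits `O(lg n)` halvings, so that
`potential`, the number of halvings still possible, pays for the rounds: a round with `k` active
points takes time `O(k lg n)` and lowers the potential by at least `k / 16`.

This requires that `p` be found in linear time. A recursive procedure (`sample`) turns `4 ^ J`
pivots into a sorted sample of size `2 ^ J`: it merges the samples of the four quarters, and keeps
every other entry. A call on level `J` takes time `O(2 ^ J)` besides its recursive calls, and there
are four times as many calls on each lower level, so that the total time is `O(4 ^ J)`. The rounding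
errors of the counts that are represented by the sample add up to less than half of the pivots, and
the entry after the first quarter of the sample is a suitable `p` (`SampleSpec.quarter`).

Time is accounted for by `Wp`, a weakest precondition that keeps track of the number of steps.
-/

/-! ### Execution with a time bound -/

namespace RealRAM

/-- `Wp procs c s Q`: the command `c` started on the store `s` terminates, and the number `T` of
steps and the final store `s'` satisfy `Q T s'`. As runs are deterministic, this is the weakest
precondition of `Q`. -/
def Wp (procs : List Cmd) (c : Cmd) (s : Store) (Q : ℕ → Store → Prop) : Prop :=
  ∃ T s', Exec procs c s T s' ∧ Q T s'

/-- Sequential composition of a list of commands. -/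
def Cmd.block : List Cmd → Cmd
  | [] => .skip
  | [c] => c
  | c :: d :: l => .seq c (Cmd.block (d :: l))

variable {procs : List Cmd} {s : Store} {Q Q' : ℕ → Store → Prop} {c d : Cmd} {p : Test}

theorem Wp.mono (h : Wp procs c s Q) (hQ : ∀ T s', Q T s' → Q' T s') : Wp procs c s Q' := by
  obtain ⟨T, s', h, h'⟩ := h
  exact ⟨T, s', h, hQ _ _ h'⟩

theorem wp_skip : Wp procs .skip s Q ↔ Q 1 s :=
  ⟨fun ⟨_, _, h, h'⟩ => by cases h; exact h', fun h => ⟨_, _, .skip s, h⟩⟩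

theorem wp_setNat {x : ℕ} {e : NatExpr} :
    Wp procs (.setNat x e) s Q ↔ Q (e.cost + 1) (s.setNat x (e.eval s)) :=
  ⟨fun ⟨_, _, h, h'⟩ => by cases h; exact h', fun h => ⟨_, _, .setNat s x e, h⟩⟩

theorem wp_setReal {x : ℕ} {e : RealExpr} :
    Wp procs (.setReal x e) s Q ↔ Q (e.cost + 1) (s.setReal x (e.eval s)) :=
  ⟨fun ⟨_, _, h, h'⟩ => by cases h; exact h', fun h => ⟨_, _, .setReal s x e, h⟩⟩

theorem wp_writeNat {k : ℕ} {i e : NatExpr} :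
    Wp procs (.writeNat k i e) s Q ↔
      Q (i.cost + e.cost + 1) (s.writeNat k (i.eval s) (e.eval s)) :=
  ⟨fun ⟨_, _, h, h'⟩ => by cases h; exact h', fun h => ⟨_, _, .writeNat s k i e, h⟩⟩

theorem wp_writeReal {k : ℕ} {i : NatExpr} {e : RealExpr} :
    Wp procs (.writeReal k i e) s Q ↔
      Q (i.cost + e.cost + 1) (s.writeReal k (i.eval s) (e.eval s)) :=
  ⟨fun ⟨_, _, h, h'⟩ => by cases h; exact h', fun h => ⟨_, _, .writeReal s k i e, h⟩⟩

theorem wp_seq : Wp procs (.seq c d) s Q ↔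
    Wp procs c s fun T₁ s₁ => Wp procs d s₁ fun T₂ s₂ => Q (T₁ + T₂) s₂ := by
  constructor
  · rintro ⟨_, _, h, h'⟩
    cases h with
    | seq h₁ h₂ => exact ⟨_, _, h₁, _, _, h₂, h'⟩
  · rintro ⟨_, _, h₁, _, _, h₂, h'⟩
    exact ⟨_, _, .seq h₁ h₂, h'⟩

theorem wp_ite : Wp procs (.ite p c d) s Q ↔
    (p.Holds s → Wp procs c s fun T s' => Q (p.cost + 1 + T) s') ∧
    (¬ p.Holds s → Wp procs d s fun T s' => Q (p.cost + 1 + T) s') := by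
  constructor
  · rintro ⟨_, _, h, h'⟩
    cases h with
    | ite_true hp h => exact ⟨fun _ => ⟨_, _, h, h'⟩, fun hn => absurd hp hn⟩
    | ite_false hp h => exact ⟨fun hn => absurd hn hp, fun _ => ⟨_, _, h, h'⟩⟩
  · rintro ⟨h₁, h₂⟩
    by_cases hp : p.Holds s
    · obtain ⟨_, _, h, h'⟩ := h₁ hp
      exact ⟨_, _, .ite_true hp h, h'⟩
    · obtain ⟨_, _, h, h'⟩ := h₂ hp
      exact ⟨_, _, .ite_false hp h, h'⟩

theorem wp_call {k : ℕ} : Wp procs (.call k) s Q ↔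
    Wp procs (procs.getD k .skip) s fun T s' => Q (T + 1) s' := by
  constructor
  · rintro ⟨_, _, h, h'⟩
    cases h with
    | call h => exact ⟨_, _, h, h'⟩
  · rintro ⟨_, _, h, h'⟩
    exact ⟨_, _, .call h, h'⟩

theorem wp_block_one : Wp procs (.block [c]) s Q ↔ Wp procs c s Q := Iff.rfl

theorem wp_block_cons {l : List Cmd} : Wp procs (.block (c :: d :: l)) s Q ↔
    Wp procs c s fun T₁ s₁ => Wp procs (.block (d :: l)) s₁ fun T₂ s₂ => Q (T₁ + T₂) s₂ :=
  wp_seq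

/-- The rule for loops: `I Φ s` is an invariant that comes with a time budget `Φ`, from which each
iteration is paid. -/
theorem wp_while (I : ℕ → Store → Prop)
    (step : ∀ Φ s, I Φ s → p.Holds s → Wp procs c s fun T s' =>
      ∃ Φ', I Φ' s' ∧ T + p.cost + 1 + Φ' ≤ Φ) (Φ : ℕ) (h : I Φ s) :
    Wp procs (.while p c) s fun T s' =>
      T ≤ Φ + p.cost + 1 ∧ ∃ Φ', I Φ' s' ∧ ¬ p.Holds s' := by
  induction Φ using Nat.strong_induction_on generalizing s with
  | _ Φ ih =>
    by_cases hp : p.Holds s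
    · obtain ⟨T, s', h₁, Φ', h₂, h₃⟩ := step Φ s h hp
      obtain ⟨T', s'', h₄, h₅, h₆⟩ := ih Φ' (by omega) h₂
      exact ⟨_, _, .while_true hp h₁ h₄, by omega, h₆⟩
    · exact ⟨_, _, .while_false hp, by omega, Φ, h, hp⟩

/-- The rule for loops with a known number `N` of iterations, each of which takes time at most
`B`. -/
theorem wp_for (I : ℕ → Store → Prop) (N B : ℕ)
    (test : ∀ j s, I j s → (p.Holds s ↔ j < N))
    (step : ∀ j s, j < N → I j s → Wp procs c s fun T s' => T ≤ B ∧ I (j + 1) s')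
    (h : I 0 s) :
    Wp procs (.while p c) s fun T s' => T ≤ N * (B + p.cost + 1) + p.cost + 1 ∧ I N s' := by
  refine (wp_while (fun Φ s => ∃ j ≤ N, Φ = (N - j) * (B + p.cost + 1) ∧ I j s) ?_
    (N * (B + p.cost + 1)) ⟨0, by omega, by simp, h⟩).mono ?_
  · rintro _ s ⟨j, hj, rfl, hI⟩ hp
    have hj' := (test j s hI).1 hp
    refine (step j s hj' hI).mono ?_
    rintro T s' ⟨hT, hI'⟩
    refine ⟨_, ⟨j + 1, hj', rfl, hI'⟩, ?_⟩
    obtain ⟨d, rfl⟩ := Nat.exists_eq_add_of_lt hj'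
    rw [show j + d + 1 - j = d + 1 by omega, show j + d + 1 - (j + 1) = d by omega, Nat.succ_mul]
    omega
  · rintro T s' ⟨hT, _, ⟨j, hj, -, hI⟩, hp⟩
    obtain rfl : j = N := by
      have := mt (test j s' hI).2 hp
      omega
    exact ⟨hT, hI⟩

section Store

variable (s : Store) (x k i v : ℕ) (r : ℝ)

@[simp] theorem natReg_setNat (y : ℕ) :
    (s.setNat x v).natReg y = if y = x then v else s.natReg y := by
  simp [Store.setNat, Function.update_apply]

@[simp] theorem realReg_setNat : (s.setNat x v).realReg = s.realReg := rfl

@[simp] theorem natArr_setNat : (s.setNat x v).natArr = s.natArr := rfl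

@[simp] theorem realArr_setNat : (s.setNat x v).realArr = s.realArr := rfl

@[simp] theorem natReg_setReal : (s.setReal x r).natReg = s.natReg := rfl

@[simp] theorem realReg_setReal (y : ℕ) :
    (s.setReal x r).realReg y = if y = x then r else s.realReg y := by
  simp [Store.setReal, Function.update_apply]

@[simp] theorem natArr_setReal : (s.setReal x r).natArr = s.natArr := rfl

@[simp] theorem realArr_setReal : (s.setReal x r).realArr = s.realArr := rfl

@[simp] theorem natReg_writeNat : (s.writeNat k i v).natReg = s.natReg := rfl

@[simp] theorem realReg_writeNat : (s.writeNat k i v).realReg = s.realReg := rfl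

@[simp] theorem natArr_writeNat (y : ℕ) : (s.writeNat k i v).natArr y =
    if y = k then Function.update (s.natArr k) i v else s.natArr y := by
  simp [Store.writeNat, Function.update_apply]

@[simp] theorem realArr_writeNat : (s.writeNat k i v).realArr = s.realArr := rfl

@[simp] theorem natReg_writeReal : (s.writeReal k i r).natReg = s.natReg := rfl

@[simp] theorem realReg_writeReal : (s.writeReal k i r).realReg = s.realReg := rfl

@[simp] theorem natArr_writeReal : (s.writeReal k i r).natArr = s.natArr := rfl

@[simp] theorem realArr_writeReal (y : ℕ) : (s.writeReal k i r).realArr y =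
    if y = k then Function.update (s.realArr k) i r else s.realArr y := by
  simp [Store.writeReal, Function.update_apply]

end Store

attribute [simp] NatExpr.eval RealExpr.eval Test.Holds NatExpr.cost RealExpr.cost Test.cost
attribute [simp] wp_skip wp_setNat wp_setReal wp_writeNat wp_writeReal wp_ite wp_block_one
attribute [simp] wp_block_cons

/-! ### Merging sorted blocks -/

/-- The part of the memory that belongs to the callers of the pivot search is the same in `s` and
`s'`. -/
structure Frame (s s' : Store) : Prop where
  natReg : ∀ y < 10, s'.natReg y = s.natReg y
  realReg : s'.realReg = s.realReg
  natArr : s'.natArr = s.natArr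
  realArr : ∀ y < 2, s'.realArr y = s.realArr y

theorem Frame.trans {s s' s'' : Store} (h : Frame s s') (h' : Frame s' s'') : Frame s s'' :=
  ⟨fun y hy => (h'.natReg y hy).trans (h.natReg y hy), h'.realReg.trans h.realReg,
    h'.natArr.trans h.natArr, fun y hy => (h'.realArr y hy).trans (h.realArr y hy)⟩

/-- The entries `f i, …, f (i + len - 1)` are in weakly increasing order. -/
def SortedOn (f : ℕ → ℝ) (i len : ℕ) : Prop :=
  ∀ u v, u ≤ v → v < len → f (i + u) ≤ f (i + v)

open Classical in
/-- The number of the entries `f i, …, f (i + len - 1)` that lie in `P`. -/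
noncomputable def countOn (P : Set ℝ) (f : ℕ → ℝ) (i len : ℕ) : ℕ :=
  ∑ u ∈ Finset.range len, if f (i + u) ∈ P then 1 else 0

theorem SortedOn.congr {f g : ℕ → ℝ} {i j len : ℕ} (h : SortedOn f i len)
    (hfg : ∀ u < len, f (i + u) = g (j + u)) : SortedOn g j len := by
  intro u v huv hv
  rw [← hfg u (by omega), ← hfg v hv]
  exact h u v huv hv

theorem countOn_congr {P : Set ℝ} {f g : ℕ → ℝ} {i j len : ℕ}
    (hfg : ∀ u < len, f (i + u) = g (j + u)) : countOn P f i len = countOn P g j len := by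
  refine Finset.sum_congr rfl fun u hu => ?_
  rw [hfg u (Finset.mem_range.1 hu)]

theorem countOn_add (P : Set ℝ) (f : ℕ → ℝ) (i len len' : ℕ) :
    countOn P f i (len + len') = countOn P f i len + countOn P f (i + len) len' := by
  rw [countOn, Finset.sum_range_add]
  refine congrArg (_ + ·) (Finset.sum_congr rfl fun u _ => ?_)
  rw [← add_assoc]

open Classical in
theorem countOn_succ (P : Set ℝ) (f : ℕ → ℝ) (i len : ℕ) :
    countOn P f i (len + 1) = countOn P f i len + if f (i + len) ∈ P then 1 else 0 :=
  Finset.sum_range_succ _ _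

@[simp] theorem countOn_zero (P : Set ℝ) (f : ℕ → ℝ) (i : ℕ) : countOn P f i 0 = 0 := rfl

/-- Merge the two topmost blocks of the stack, each of size `natReg 11`, into the array `3`, and
take them off the stack. The stack is the real array `2`, and its height is `natReg 13`. -/
def mergeTop : Cmd :=
  let X : RealExpr := .read 2 (.add (.reg 13) (.reg 14))
  let Y : RealExpr := .read 2 (.add (.add (.reg 13) (.reg 11)) (.reg 15))
  .block [
    .setNat 13 (.sub (.reg 13) (.add (.reg 11) (.reg 11))),
    .setNat 14 (.const 0),
    .setNat 15 (.const 0),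
    .setNat 16 (.const 0),
    .while (.natLt (.reg 16) (.add (.reg 11) (.reg 11))) (.block [
      .ite (.or (.natEq (.reg 15) (.reg 11))
          (.and (.natLt (.reg 14) (.reg 11)) (.not (.realLt Y X))))
        (.block [.writeReal 3 (.reg 16) X, .setNat 14 (.add (.reg 14) (.const 1))])
        (.block [.writeReal 3 (.reg 16) Y, .setNat 15 (.add (.reg 15) (.const 1))]),
      .setNat 16 (.add (.reg 16) (.const 1))])]

/-- The invariant of the loop of `mergeTop`: the first `i` entries of the first block and the first
`j` entries of the second block (of size `σ` each, in `f` from `base` on) have been merged into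
`g`. -/
structure MergeInv (f g : ℕ → ℝ) (base σ i j : ℕ) : Prop where
  fst_le : i ≤ σ
  snd_le : j ≤ σ
  sorted : SortedOn g 0 (i + j)
  le_fst : ∀ u v, u < i + j → i ≤ v → v < σ → g u ≤ f (base + v)
  le_snd : ∀ u v, u < i + j → j ≤ v → v < σ → g u ≤ f (base + σ + v)
  count : ∀ P, countOn P g 0 (i + j) = countOn P f base i + countOn P f (base + σ) j

theorem SortedOn.update {g : ℕ → ℝ} {o : ℕ} {x : ℝ} (h : SortedOn g 0 o)
    (hx : ∀ u < o, g u ≤ x) : SortedOn (Function.update g o x) 0 (o + 1) := by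
  intro u v huv hv
  simp only [Function.update_apply, Nat.zero_add]
  split_ifs with h₁ h₂ h₂
  · exact le_rfl
  · omega
  · exact hx u (by omega)
  · simpa using h u v huv (by omega)

theorem countOn_update (P : Set ℝ) (g : ℕ → ℝ) (o : ℕ) (x : ℝ) [Decidable (x ∈ P)] :
    countOn P (Function.update g o x) 0 (o + 1) = countOn P g 0 o + if x ∈ P then 1 else 0 := by
  rw [countOn_succ]
  congr 1
  · exact countOn_congr fun u hu => by simp [hu.ne]
  · simp

theorem MergeInv.fst {f g : ℕ → ℝ} {base σ i j : ℕ} (h : MergeInv f g base σ i j)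
    (hf : SortedOn f base σ) (hi : i < σ)
    (hle : j = σ ∨ SortedOn f (base + σ) σ ∧ f (base + i) ≤ f (base + σ + j)) :
    MergeInv f (Function.update g (i + j) (f (base + i))) base σ (i + 1) j := by
  classical
  have key : ∀ u, u < i + 1 + j → Function.update g (i + j) (f (base + i)) u ≤ f (base + i) := by
    intro u hu
    rw [Function.update_apply]
    split_ifs
    · exact le_rfl
    · exact h.le_fst u i (by omega) le_rfl hi
  refine ⟨hi, h.snd_le, ?_, ?_, ?_, ?_⟩
  · rw [add_right_comm]
    exact h.sorted.update fun u hu => h.le_fst u i hu le_rfl hi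
  · exact fun u v hu hv hvσ => (key u hu).trans (hf i v (by omega) hvσ)
  · intro u v hu hv hvσ
    rcases hle with rfl | ⟨hs, hle⟩
    · omega
    · exact (key u hu).trans (hle.trans (hs j v hv hvσ))
  · intro P
    rw [add_right_comm, countOn_update, h.count, countOn_succ]
    omega

theorem MergeInv.snd {f g : ℕ → ℝ} {base σ i j : ℕ} (h : MergeInv f g base σ i j)
    (hf : SortedOn f (base + σ) σ) (hj : j < σ)
    (hle : i = σ ∨ SortedOn f base σ ∧ f (base + σ + j) ≤ f (base + i)) :
    MergeInv f (Function.update g (i + j) (f (base + σ + j))) base σ i (j + 1) := by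
  classical
  have key : ∀ u, u < i + j + 1 →
      Function.update g (i + j) (f (base + σ + j)) u ≤ f (base + σ + j) := by
    intro u hu
    rw [Function.update_apply]
    split_ifs
    · exact le_rfl
    · exact h.le_snd u j (by omega) le_rfl hj
  refine ⟨h.fst_le, hj, ?_, ?_, ?_, ?_⟩
  · rw [← add_assoc]
    exact h.sorted.update fun u hu => h.le_snd u j hu le_rfl hj
  · intro u v hu hv hvσ
    rcases hle with rfl | ⟨hs, hle⟩
    · omega
    · exact (key u hu).trans (hle.trans (hs i v hv hvσ))
  · exact fun u v hu hv hvσ => (key u hu).trans (hf j v (by omega) hvσ)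
  · intro P
    rw [← add_assoc, countOn_update, h.count, countOn_succ]
    omega

theorem wp_mergeTop (procs : List Cmd) (s : Store) (base σ : ℕ) (hσ : s.natReg 11 = σ)
    (hsp : s.natReg 13 = base + σ + σ) (h₁ : SortedOn (s.realArr 2) base σ)
    (h₂ : SortedOn (s.realArr 2) (base + σ) σ) :
    Wp procs mergeTop s fun T s' => T ≤ 100 * σ + 100 ∧ Frame s s' ∧
      s'.natReg 10 = s.natReg 10 ∧ s'.natReg 11 = σ ∧ s'.natReg 12 = s.natReg 12 ∧
      s'.natReg 13 = base ∧ s'.realArr 2 = s.realArr 2 ∧ SortedOn (s'.realArr 3) 0 (σ + σ) ∧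
      ∀ P, countOn P (s'.realArr 3) 0 (σ + σ) = countOn P (s.realArr 2) base (σ + σ) := by
  simp only [mergeTop, wp_block_cons, wp_block_one, wp_setNat]
  refine (wp_for (fun o s' => Frame s s' ∧
      s'.natReg 10 = s.natReg 10 ∧ s'.natReg 11 = σ ∧ s'.natReg 12 = s.natReg 12 ∧
      s'.natReg 13 = base ∧ s'.realArr 2 = s.realArr 2 ∧ s'.natReg 16 = o ∧
      s'.natReg 14 + s'.natReg 15 = o ∧
      MergeInv (s.realArr 2) (s'.realArr 3) base σ (s'.natReg 14) (s'.natReg 15))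
      (σ + σ) 40 ?_ ?_ ?_).mono ?_
  · rintro o s' ⟨-, -, h11, -, -, -, h16, -, -⟩
    simp [h11, h16]
  · rintro o s' ho ⟨hF, h10, h11, h12, h13, hst, h16, h1415, hI⟩
    have hi := hI.fst_le
    have hj := hI.snd_le
    simp only [wp_block_cons, wp_block_one, wp_ite, wp_writeReal, wp_setNat]
    constructor
    · intro hp
      simp [h11, h13, hst] at hp
      refine ⟨by simp, ⟨?_, hF.realReg, hF.natArr, ?_⟩, ?_⟩
      · intro y hy
        have h14 : y ≠ 14 := by omega
        have h16 : y ≠ 16 := by omega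
        simp [h14, h16, hF.natReg y hy]
      · intro y hy
        have h3 : y ≠ 3 := by omega
        simp [h3, hF.realArr y hy]
      · simp [h10, h11, h12, h13, hst, h16]
        refine ⟨by omega, ?_⟩
        rw [← h1415]
        refine hI.fst h₁ (by omega) ?_
        rcases hp with hp | hp
        · exact .inl hp
        · exact .inr ⟨h₂, hp.2⟩
    · intro hp
      simp [h11, h13, hst] at hp
      refine ⟨by simp, ⟨?_, hF.realReg, hF.natArr, ?_⟩, ?_⟩
      · intro y hy
        have h14 : y ≠ 15 := by omega
        have h16 : y ≠ 16 := by omega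
        simp [h14, h16, hF.natReg y hy]
      · intro y hy
        have h3 : y ≠ 3 := by omega
        simp [h3, hF.realArr y hy]
      · simp [h10, h11, h12, h13, hst, h16]
        refine ⟨by omega, ?_⟩
        rw [← h1415]
        refine hI.snd h₂ (by omega) ?_
        by_cases h : s'.natReg 14 < σ
        · exact .inr ⟨h₁, (hp.2 h).le⟩
        · exact .inl (by omega)
  · refine ⟨⟨?_, rfl, rfl, fun _ _ => rfl⟩, ?_⟩
    · intro y hy
      have h13 : y ≠ 13 := by omega
      have h14 : y ≠ 14 := by omega
      have h15 : y ≠ 15 := by omega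
      have h16 : y ≠ 16 := by omega
      simp [h13, h14, h15, h16]
    · simp [hσ, hsp]
      refine ⟨by omega, ⟨by omega, by omega, ?_, ?_, ?_, ?_⟩⟩
      · intro u v _ h; omega
      · intro u v h; omega
      · intro u v h; omega
      · simp
  · rintro T s' ⟨hT, hF, h10, h11, h12, h13, hst, h16, h1415, hI⟩
    have hi := hI.fst_le
    have hj := hI.snd_le
    obtain ⟨e1, e2⟩ : s'.natReg 14 = σ ∧ s'.natReg 15 = σ := by omega
    rw [e1, e2] at hI
    refine ⟨?_, hF, h10, h11, h12, h13, hst, hI.sorted, ?_⟩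
    · simp at hT ⊢
      omega
    · intro P
      rw [hI.count, countOn_add]

/-- Push the entries of the array `3` at the indices `idx` on the stack, where `natReg 14` runs
through `0, …, len - 1`. -/
def pushTmp (len idx : NatExpr) : Cmd :=
  .block [
    .setNat 14 (.const 0),
    .while (.natLt (.reg 14) len) (.block [
      .writeReal 2 (.add (.reg 13) (.reg 14)) (.read 3 idx),
      .setNat 14 (.add (.reg 14) (.const 1))]),
    .setNat 13 (.add (.reg 13) len)]

theorem wp_pushTmp (procs : List Cmd) (s : Store) (len idx : NatExpr) (L sp : ℕ) (h : ℕ → ℕ)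
    (hlen : ∀ s' : Store, s'.natReg 11 = s.natReg 11 → len.eval s' = L)
    (hidx : ∀ s' : Store, idx.eval s' = h (s'.natReg 14))
    (hc : len.cost ≤ 5) (hc' : idx.cost ≤ 5) (hsp : s.natReg 13 = sp) :
    Wp procs (pushTmp len idx) s fun T s' => T ≤ 40 * L + 40 ∧ Frame s s' ∧
      s'.natReg 10 = s.natReg 10 ∧ s'.natReg 11 = s.natReg 11 ∧ s'.natReg 12 = s.natReg 12 ∧
      s'.natReg 13 = sp + L ∧ (∀ u < sp, s'.realArr 2 u = s.realArr 2 u) ∧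
      ∀ u < L, s'.realArr 2 (sp + u) = s.realArr 3 (h u) := by
  simp only [pushTmp, wp_block_cons, wp_block_one, wp_setNat]
  refine (wp_for (fun o s' => Frame s s' ∧
      s'.natReg 10 = s.natReg 10 ∧ s'.natReg 11 = s.natReg 11 ∧ s'.natReg 12 = s.natReg 12 ∧
      s'.natReg 13 = sp ∧ s'.natReg 14 = o ∧ s'.realArr 3 = s.realArr 3 ∧
      (∀ u < sp, s'.realArr 2 u = s.realArr 2 u) ∧
      ∀ u < o, s'.realArr 2 (sp + u) = s.realArr 3 (h u)) L 20 ?_ ?_ ?_).mono ?_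
  · rintro o s' ⟨-, -, h11, -, -, h14, -⟩
    simp [hlen s' h11, h14]
  · rintro o s' ho ⟨hF, h10, h11, h12, h13, h14, h3, hlo, hhi⟩
    simp only [wp_block_cons, wp_block_one, wp_writeReal, wp_setNat]
    refine ⟨by simp; omega, ⟨?_, hF.realReg, hF.natArr, ?_⟩, ?_⟩
    · intro y hy
      have h14 : y ≠ 14 := by omega
      simp [h14, hF.natReg y hy]
    · intro y hy
      have h2 : y ≠ 2 := by omega
      simp [h2, hF.realArr y hy]
    · simp [h10, h11, h12, h13, h14, h3, hidx]
      constructor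
      · intro u hu
        rw [Function.update_of_ne (by omega), hlo u hu]
      · intro u hu
        rcases hu.lt_or_eq with hu | rfl
        · rw [Function.update_of_ne (by omega), hhi u hu]
        · simp
  · refine ⟨⟨?_, rfl, rfl, fun _ _ => rfl⟩, ?_⟩
    · intro y hy
      have h14 : y ≠ 14 := by omega
      simp [h14]
    · simp [hsp]
  · rintro T s' ⟨hT, hF, h10, h11, h12, h13, h14, h3, hlo, hhi⟩
    have e := hlen s' h11
    refine ⟨?_, ⟨?_, hF.realReg, hF.natArr, hF.realArr⟩, ?_⟩
    · simp only [NatExpr.cost, Test.cost] at hT ⊢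
      have : L * (20 + (1 + len.cost + 1) + 1) ≤ L * 40 := Nat.mul_le_mul_left _ (by omega)
      omega
    · intro y hy
      have h13 : y ≠ 13 := by omega
      simp [h13, hF.natReg y hy]
    · simp [h10, h11, h12, h13, e]
      exact ⟨hlo, hhi⟩

theorem countOn_le (P : Set ℝ) (f : ℕ → ℝ) (i len : ℕ) : countOn P f i len ≤ len := by
  classical
  induction len with
  | zero => simp
  | succ len ih =>
    rw [countOn_succ]
    split_ifs <;> omega

theorem countOn_eq {P : Set ℝ} {f : ℕ → ℝ} {i len : ℕ} (h : ∀ u < len, f (i + u) ∈ P) :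
    countOn P f i len = len := by
  classical
  rw [countOn, Finset.sum_congr rfl fun u hu => if_pos (h u (Finset.mem_range.1 hu))]
  simp

/-- Dropping every other entry of a sorted block halves the number of the entries that lie in a
lower set, up to rounding. -/
theorem countOn_odd {P : Set ℝ} (hP : IsLowerSet P) {f g : ℕ → ℝ} {i L : ℕ}
    (hf : SortedOn f 0 (L + L)) (hg : ∀ u < L, g (i + u) = f (u + u + 1)) :
    2 * countOn P g i L ≤ countOn P f 0 (L + L) ∧
      countOn P f 0 (L + L) ≤ 2 * countOn P g i L + 1 := by
  classical
  induction L with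
  | zero => simp
  | succ L ih =>
    have hle : f (L + L) ≤ f (L + L + 1) := by
      simpa using hf (L + L) (L + L + 1) (by omega) (by omega)
    obtain ⟨ih₁, ih₂⟩ := ih (fun u v huv hv => hf u v huv (by omega)) fun u hu => hg u (by omega)
    rw [show L + 1 + (L + 1) = L + L + 1 + 1 by omega, countOn_succ, countOn_succ, countOn_succ,
      hg L (by omega), Nat.zero_add, Nat.zero_add]
    by_cases h₁ : f (L + L + 1) ∈ P
    · simp only [if_pos h₁, if_pos (hP hle h₁)]
      omega
    · simp only [if_neg h₁]
      by_cases h₂ : f (L + L) ∈ P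
      · have h₃ : countOn P f 0 (L + L) = L + L := countOn_eq fun u hu =>
          hP (by simpa using hf u (L + L) (by omega) (by omega)) h₂
        have h₄ : countOn P g i L = L := countOn_eq fun u hu => by
          rw [hg u (by omega)]
          exact hP (by simpa using hf (u + u + 1) (L + L) (by omega) (by omega)) h₂
        rw [if_pos h₂]
        omega
      · rw [if_neg h₂]
        omega

theorem SortedOn.odd {f g : ℕ → ℝ} {i L : ℕ} (hf : SortedOn f 0 (L + L))
    (hg : ∀ u < L, g (i + u) = f (u + u + 1)) : SortedOn g i L := by
  intro u v huv hv
  rw [hg u (by omega), hg v hv]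
  simpa using hf (u + u + 1) (v + v + 1) (by omega) (by omega)

/-- Two adjacent sorted blocks on top of the stack are replaced by a single one. -/
theorem wp_merge (procs : List Cmd) (s : Store) (base σ : ℕ) (hσ : s.natReg 11 = σ)
    (hsp : s.natReg 13 = base + σ + σ) (h₁ : SortedOn (s.realArr 2) base σ)
    (h₂ : SortedOn (s.realArr 2) (base + σ) σ) :
    Wp procs (.seq mergeTop (pushTmp (.add (.reg 11) (.reg 11)) (.reg 14))) s fun T s' =>
      T ≤ 180 * σ + 140 ∧ Frame s s' ∧
      s'.natReg 10 = s.natReg 10 ∧ s'.natReg 11 = σ ∧ s'.natReg 12 = s.natReg 12 ∧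
      s'.natReg 13 = base + (σ + σ) ∧ (∀ u < base, s'.realArr 2 u = s.realArr 2 u) ∧
      SortedOn (s'.realArr 2) base (σ + σ) ∧
      ∀ P, countOn P (s'.realArr 2) base (σ + σ) = countOn P (s.realArr 2) base (σ + σ) := by
  rw [wp_seq]
  refine (wp_mergeTop procs s base σ hσ hsp h₁ h₂).mono ?_
  rintro T₁ s₁ ⟨hT₁, hF₁, h10, h11, h12, h13, h2, hs, hP⟩
  refine (wp_pushTmp procs s₁ _ _ (σ + σ) base id (fun s' h => by simp [h, h11]) (fun s' => rfl)
    (by simp) (by simp) h13).mono ?_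
  rintro T₂ s₂ ⟨hT₂, hF₂, k10, k11, k12, k13, hlo, hhi⟩
  have hhi' : ∀ u < σ + σ, s₁.realArr 3 (0 + u) = s₂.realArr 2 (base + u) := fun u hu => by
    rw [hhi u hu, id, Nat.zero_add]
  refine ⟨by omega, hF₁.trans hF₂, k10.trans h10, k11.trans h11, k12.trans h12, k13, ?_,
    hs.congr hhi', ?_⟩
  · intro u hu
    rw [hlo u hu, h2]
  · intro P
    rw [← countOn_congr hhi', hP]

/-- Two adjacent sorted blocks on top of the stack are merged, and every other entry is kept. -/
theorem wp_merge_odd (procs : List Cmd) (s : Store) (base σ : ℕ) (hσ : s.natReg 11 = σ)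
    (hsp : s.natReg 13 = base + σ + σ) (h₁ : SortedOn (s.realArr 2) base σ)
    (h₂ : SortedOn (s.realArr 2) (base + σ) σ) :
    Wp procs (.seq mergeTop
      (pushTmp (.reg 11) (.add (.add (.reg 14) (.reg 14)) (.const 1)))) s fun T s' =>
      T ≤ 140 * σ + 140 ∧ Frame s s' ∧
      s'.natReg 10 = s.natReg 10 ∧ s'.natReg 11 = σ ∧ s'.natReg 12 = s.natReg 12 ∧
      s'.natReg 13 = base + σ ∧ (∀ u < base, s'.realArr 2 u = s.realArr 2 u) ∧
      SortedOn (s'.realArr 2) base σ ∧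
      ∀ P, IsLowerSet P →
        2 * countOn P (s'.realArr 2) base σ ≤ countOn P (s.realArr 2) base (σ + σ) ∧
        countOn P (s.realArr 2) base (σ + σ) ≤ 2 * countOn P (s'.realArr 2) base σ + 1 := by
  rw [wp_seq]
  refine (wp_mergeTop procs s base σ hσ hsp h₁ h₂).mono ?_
  rintro T₁ s₁ ⟨hT₁, hF₁, h10, h11, h12, h13, h2, hs, hP⟩
  refine (wp_pushTmp procs s₁ _ _ σ base (fun u => u + u + 1) (fun s' h => by simp [h, h11])
    (fun s' => rfl) (by simp) (by simp) h13).mono ?_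
  rintro T₂ s₂ ⟨hT₂, hF₂, k10, k11, k12, k13, hlo, hhi⟩
  refine ⟨by omega, hF₁.trans hF₂, k10.trans h10, k11.trans h11, k12.trans h12, k13, ?_,
    hs.odd hhi, ?_⟩
  · intro u hu
    rw [hlo u hu, h2]
  · intro P hlow
    rw [← hP]
    exact countOn_odd hlow hs hhi

/-! ### A sorted sample of the pivots -/

/-- The pivot of the `u`-th active point `b`: the translation that takes `b` to the boundary in the
middle of its current range of Voronoi cells. -/
noncomputable def pivotAt (s : Store) (u : ℕ) : ℝ :=
  let x := s.natArr 2 u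
  let i := (s.natArr 0 x + s.natArr 1 x) / 2
  (s.realArr 0 i + s.realArr 0 (i + 1)) / 2 - s.realArr 1 x

/-- The expression for `pivotAt`. -/
def pivotExpr (u : NatExpr) : RealExpr :=
  let x : NatExpr := .read 2 u
  let i : NatExpr := .half (.add (.read 0 x) (.read 1 x))
  .sub (.div (.add (.read 0 i) (.read 0 (.add i (.const 1)))) (.const 2)) (.read 1 x)

theorem eval_pivotExpr (s : Store) (u : NatExpr) :
    (pivotExpr u).eval s = pivotAt s (u.eval s) := by
  simp [pivotExpr, pivotAt]

theorem Frame.pivotAt {s s' : Store} (h : Frame s s') : pivotAt s' = pivotAt s := by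
  funext u
  simp [RealRAM.pivotAt, h.natArr, h.realArr]

/-- The recursive procedure that puts a sorted sample of `2 ^ J` out of the next `4 ^ J` pivots on
the stack, where `J` is in `natReg 10`, and the position of the next pivot is in `natReg 12`. The
size of the sample is stored in `natReg 11`. -/
def sample : Cmd :=
  let merge := Cmd.seq mergeTop (pushTmp (.add (.reg 11) (.reg 11)) (.reg 14))
  let mergeOdd :=
    Cmd.seq mergeTop (pushTmp (.reg 11) (.add (.add (.reg 14) (.reg 14)) (.const 1)))
  .ite (.natEq (.reg 10) (.const 0))
    (.block [
      .writeReal 2 (.reg 13) (pivotExpr (.reg 12)),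
      .setNat 13 (.add (.reg 13) (.const 1)),
      .setNat 12 (.add (.reg 12) (.const 1)),
      .setNat 11 (.const 1)])
    (.block [
      .setNat 10 (.sub (.reg 10) (.const 1)),
      .call 0, .call 0, merge,
      .call 0, .call 0, merge,
      .setNat 11 (.add (.reg 11) (.reg 11)),
      mergeOdd,
      .setNat 10 (.add (.reg 10) (.const 1))])

/-- The outcome of `sample` on the level `J`: the sorted sample `s'.realArr 2` represents the
pivots, each of its `2 ^ J` entries standing for `2 ^ J` of them, and the number of the pivots in a
lower set is underestimated by at most `(4 ^ J - 2 ^ J) / 2`. -/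
structure SampleSpec (J : ℕ) (s s' : Store) : Prop where
  frame : Frame s s'
  level : s'.natReg 10 = J
  size : s'.natReg 11 = 2 ^ J
  pos : s'.natReg 12 = s.natReg 12 + 4 ^ J
  height : s'.natReg 13 = s.natReg 13 + 2 ^ J
  below : ∀ u < s.natReg 13, s'.realArr 2 u = s.realArr 2 u
  sorted : SortedOn (s'.realArr 2) (s.natReg 13) (2 ^ J)
  count : ∀ P, IsLowerSet P →
    2 ^ J * countOn P (s'.realArr 2) (s.natReg 13) (2 ^ J) ≤
      countOn P (pivotAt s) (s.natReg 12) (4 ^ J) ∧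
    2 * countOn P (pivotAt s) (s.natReg 12) (4 ^ J) + 2 ^ J ≤
      2 * (2 ^ J * countOn P (s'.realArr 2) (s.natReg 13) (2 ^ J)) + 4 ^ J

/-- Two consecutive calls of `sample`, followed by a merge of the two samples. -/
theorem wp_sample_pair {procs : List Cmd} {J : ℕ}
    (ih : ∀ s : Store, s.natReg 10 = J → Wp procs (procs.getD 0 .skip) s fun T s' =>
      T + 600 * 2 ^ J ≤ 700 * 4 ^ J ∧ SampleSpec J s s')
    (s : Store) (hJ : s.natReg 10 = J) (c : Cmd) (l : List Cmd) (Q : ℕ → Store → Prop)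
    (hQ : ∀ T s', T + 1200 * 2 ^ J ≤ 1400 * 4 ^ J + 180 * 2 ^ J + 142 → Frame s s' →
      s'.natReg 10 = J → s'.natReg 11 = 2 ^ J → s'.natReg 12 = s.natReg 12 + 4 ^ J + 4 ^ J →
      s'.natReg 13 = s.natReg 13 + (2 ^ J + 2 ^ J) →
      (∀ u < s.natReg 13, s'.realArr 2 u = s.realArr 2 u) →
      SortedOn (s'.realArr 2) (s.natReg 13) (2 ^ J + 2 ^ J) →
      (∀ P, IsLowerSet P →
        2 ^ J * countOn P (s'.realArr 2) (s.natReg 13) (2 ^ J + 2 ^ J) ≤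
          countOn P (pivotAt s) (s.natReg 12) (4 ^ J + 4 ^ J) ∧
        2 * countOn P (pivotAt s) (s.natReg 12) (4 ^ J + 4 ^ J) + 2 * 2 ^ J ≤
          2 * (2 ^ J * countOn P (s'.realArr 2) (s.natReg 13) (2 ^ J + 2 ^ J)) + 2 * 4 ^ J) →
      Wp procs (.block (c :: l)) s' fun T' s'' => Q (T + T') s'') :
    Wp procs (.block (.call 0 :: .call 0 ::
      .seq mergeTop (pushTmp (.add (.reg 11) (.reg 11)) (.reg 14)) :: c :: l)) s Q := by
  rw [wp_block_cons, wp_call]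
  refine (ih s hJ).mono ?_
  rintro T₁ s₁ ⟨hT₁, h₁⟩
  rw [wp_block_cons, wp_call]
  refine (ih s₁ h₁.level).mono ?_
  rintro T₂ s₂ ⟨hT₂, h₂⟩
  rw [wp_block_cons]
  have e₁ : ∀ u < 2 ^ J, s₁.realArr 2 (s.natReg 13 + u) = s₂.realArr 2 (s.natReg 13 + u) :=
    fun u hu => (h₂.below _ (by rw [h₁.height]; omega)).symm
  refine (wp_merge procs s₂ (s.natReg 13) (2 ^ J) h₂.size (by rw [h₂.height, h₁.height])
    (h₁.sorted.congr e₁) (by rw [← h₁.height]; exact h₂.sorted)).mono ?_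
  rintro T₃ s₃ ⟨hT₃, hF, h10, h11, h12, h13, hlo, hs, hP⟩
  have hw := hQ (T₁ + 1 + (T₂ + 1) + T₃) s₃ (by omega) ((h₁.frame.trans h₂.frame).trans hF)
    (h10.trans h₂.level) h11 (by rw [h12, h₂.pos, h₁.pos]) h13
    (fun u hu => by rw [hlo u hu, h₂.below u (by rw [h₁.height]; omega), h₁.below u hu]) hs ?_
  · simpa only [add_assoc] using hw
  · intro P hlow
    obtain ⟨a₁, b₁⟩ := h₁.count P hlow
    obtain ⟨a₂, b₂⟩ := h₂.count P hlow
    rw [hP, countOn_add, countOn_add, ← countOn_congr e₁, ← h₁.height, ← h₁.pos,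
      ← h₁.frame.pivotAt, Nat.mul_add]
    rw [h₁.frame.pivotAt] at *
    omega

/-- The summand `600 * 2 ^ J` makes the induction work: it absorbs the time of the merges. -/
theorem wp_sample {procs : List Cmd} (hp : procs.getD 0 .skip = sample) (J : ℕ) (s : Store)
    (hJ : s.natReg 10 = J) : Wp procs sample s fun T s' =>
      T + 600 * 2 ^ J ≤ 700 * 4 ^ J ∧ SampleSpec J s s' := by
  induction J generalizing s with
  | zero =>
    rw [sample, wp_ite]
    refine ⟨fun _ => ?_, fun h => absurd (by simpa using hJ) h⟩
    simp only [wp_block_cons, wp_block_one, wp_writeReal, wp_setNat, eval_pivotExpr]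
    refine ⟨by simp [pivotExpr], ⟨⟨?_, rfl, rfl, ?_⟩, ?_, ?_, ?_, ?_, ?_, ?_, ?_⟩⟩
    · intro y hy
      have h11 : y ≠ 11 := by omega
      have h12 : y ≠ 12 := by omega
      have h13 : y ≠ 13 := by omega
      simp [h11, h12, h13]
    · intro y hy
      have h2 : y ≠ 2 := by omega
      simp [h2]
    · simp [hJ]
    · simp
    · simp
    · simp
    · intro u hu
      simp [hu.ne]
    · intro u v huv hv
      obtain rfl : u = v := by omega
      exact le_rfl
    · intro P _
      have e : countOn P ((s.writeReal 2 (s.natReg 13) (pivotAt s (s.natReg 12))).realArr 2)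
          (s.natReg 13) 1 = countOn P (pivotAt s) (s.natReg 12) 1 := by
        refine countOn_congr fun u hu => ?_
        obtain rfl : u = 0 := by omega
        simp
      simp only [pow_zero, one_mul, realArr_setNat, NatExpr.eval, e]
      omega
  | succ J ih =>
    rw [sample, wp_ite]
    refine ⟨fun h => by simp [hJ] at h, fun _ => ?_⟩
    rw [wp_block_cons, wp_setNat]
    rw [← hp] at ih
    refine wp_sample_pair ih _ (by simp [hJ]) _ _ _ ?_
    intro T₁ s₁ hT₁ hF₁ h10 h11 h12 h13 hlo hs hP
    refine wp_sample_pair ih _ h10 _ _ _ ?_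
    intro T₂ s₂ hT₂ hF₂ k10 k11 k12 k13 klo ks kP
    rw [wp_block_cons, wp_setNat, wp_block_cons]
    set σ := 2 ^ J with hσ
    have hF₀ : Frame s (s.setNat 10 ((NatExpr.sub (.reg 10) (.const 1)).eval s)) := by
      refine ⟨fun y hy => ?_, rfl, rfl, fun _ _ => rfl⟩
      have h10 : y ≠ 10 := by omega
      simp [h10]
    have hF₃ : Frame s₂ (s₂.setNat 11 ((NatExpr.add (.reg 11) (.reg 11)).eval s₂)) := by
      refine ⟨fun y hy => ?_, rfl, rfl, fun _ _ => rfl⟩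
      have h11 : y ≠ 11 := by omega
      simp [h11]
    have ev : pivotAt s₁ = pivotAt s := (hF₀.trans hF₁).pivotAt
    have ev₀ := hF₀.pivotAt
    simp only [natReg_setNat, realArr_setNat] at h12 h13 hlo hs hP
    rw [ev₀] at hP
    norm_num at h12 h13 hlo hs hP
    have e₁ : ∀ u < σ + σ, s₁.realArr 2 (s.natReg 13 + u) = s₂.realArr 2 (s.natReg 13 + u) :=
      fun u hu => (klo _ (by omega)).symm
    refine (wp_merge_odd procs _ (s.natReg 13) (σ + σ) (by simp [k11]) ?_ ?_ ?_).mono ?_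
    · simp [k13, h13]
    · exact hs.congr e₁
    · rw [← h13]
      exact ks
    · rintro T₃ s₃ ⟨hT₃, hF, l10, l11, l12, l13, llo, ls, lP⟩
      simp only [natReg_setNat, realArr_setNat] at l10 l12 llo lP
      norm_num at l10 l12 llo lP
      have e4 : 4 ^ J = σ * σ := by rw [hσ, ← mul_pow]; rfl
      have e2 : 2 ^ (J + 1) = σ + σ := by rw [pow_succ, ← hσ]; omega
      have e4' : 4 ^ (J + 1) = 4 ^ J + 4 ^ J + (4 ^ J + 4 ^ J) := by rw [pow_succ]; omega
      rw [wp_block_one, wp_setNat]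
      have hσ1 : 1 ≤ σ := Nat.one_le_two_pow
      refine ⟨?_, ⟨?_, ?_, ?_, ?_, ?_, ?_, ?_, ?_⟩⟩
      · simp
        omega
      · refine (((hF₀.trans hF₁).trans hF₂).trans (hF₃.trans hF)).trans
          ⟨fun y hy => ?_, rfl, rfl, fun _ _ => rfl⟩
        have h10 : y ≠ 10 := by omega
        simp [h10]
      · simp [l10, k10]
      · simp [l11, e2]
      · simp [l12, k12, h12, e4']
        omega
      · simp [l13, e2]
      · intro u hu
        simp [llo u hu, klo u (by omega), hlo u hu]
      · simpa [e2] using ls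
      · intro P hlow
        obtain ⟨a₁, b₁⟩ := hP P hlow
        obtain ⟨a₂, b₂⟩ := kP P hlow
        obtain ⟨a₃, b₃⟩ := lP P hlow
        rw [countOn_add P (s₂.realArr 2)] at a₃ b₃
        rw [← countOn_congr e₁, ← h13] at a₃ b₃
        rw [h12, ev] at a₂ b₂
        rw [e2, e4', countOn_add P (pivotAt s), ← add_assoc (s.natReg 12)]
        simp only [realArr_setNat]
        set A := countOn P (s₃.realArr 2) (s.natReg 13) (σ + σ)
        set B₁ := countOn P (s₁.realArr 2) (s.natReg 13) (σ + σ)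
        set B₂ := countOn P (s₂.realArr 2) (s₁.natReg 13) (σ + σ)
        rw [e4] at *
        have f₁ := Nat.mul_le_mul_left σ a₃
        have f₂ := Nat.mul_le_mul_left σ b₃
        simp only [Nat.mul_add, Nat.add_mul, Nat.mul_left_comm σ 2] at *
        constructor <;> omega

/-! ### Voronoi cells and brackets -/

/-- The boundary between the Voronoi cells of the consecutive points `a i` and `a (i + 1)`. -/
noncomputable def boundary (a : ℕ → ℝ) (i : ℕ) : ℝ := (a i + a (i + 1)) / 2

/-- The index of the Voronoi cell of `x` with respect to the points `a 0 < ⋯ < a (n - 1)`; a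
boundary point is counted to the cell on its left. -/
noncomputable def cell (n : ℕ) (a : ℕ → ℝ) (x : ℝ) : ℕ := sInf {c | n ≤ c + 1 ∨ x ≤ boundary a c}

/-- The sum of the squared distances of the points `b x + t`, `x < m`, from the points `a (c x)`
to which they are assigned. -/
noncomputable def assignedRMS (m : ℕ) (a b : ℕ → ℝ) (c : ℕ → ℕ) (t : ℝ) : ℝ :=
  ∑ x ∈ Finset.range m, (b x + t - a (c x)) ^ 2

/-- Half of the left derivative of the RMS distance under translation. -/
noncomputable def halfSlope (n m : ℕ) (a b : ℕ → ℝ) (t : ℝ) : ℝ :=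
  ∑ x ∈ Finset.range m, (b x + t - a (cell n a (b x + t)))

section Cell

variable {n : ℕ} {a : ℕ → ℝ} {x y : ℝ} {c i j : ℕ}

theorem boundary_mono (ha : StrictMonoOn a (Set.Iio n)) (hij : i ≤ j) (hj : j + 1 < n) :
    boundary a i ≤ boundary a j := by
  have h₁ : a i ≤ a j := ha.monotoneOn (Set.mem_Iio.2 (by omega)) (Set.mem_Iio.2 (by omega)) hij
  have h₂ : a (i + 1) ≤ a (j + 1) :=
    ha.monotoneOn (Set.mem_Iio.2 (by omega)) (Set.mem_Iio.2 (by omega)) (by omega)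
  unfold boundary
  linarith

theorem cell_spec (n : ℕ) (a : ℕ → ℝ) (x : ℝ) :
    n ≤ cell n a x + 1 ∨ x ≤ boundary a (cell n a x) :=
  Nat.sInf_mem (s := {c | n ≤ c + 1 ∨ x ≤ boundary a c}) ⟨n, .inl (by omega)⟩

theorem of_lt_cell (h : i < cell n a x) : i + 1 < n ∧ boundary a i < x := by
  simpa using Nat.notMem_of_lt_sInf h

theorem cell_le (h : n ≤ c + 1 ∨ x ≤ boundary a c) : cell n a x ≤ c := Nat.sInf_le h

theorem cell_lt (hn : 0 < n) : cell n a x < n := by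
  have := cell_le (a := a) (x := x) (c := n - 1) (n := n) (.inl (by omega))
  omega

theorem cell_eq (hc : c < n) (h₁ : ∀ i < c, boundary a i < x) (h₂ : c + 1 < n → x ≤ boundary a c) :
    cell n a x = c := by
  refine le_antisymm (cell_le ?_) (not_lt.1 fun h => ?_)
  · by_cases h : c + 1 < n
    · exact .inr (h₂ h)
    · exact .inl (by omega)
  · rcases cell_spec n a x with h' | h'
    · omega
    · exact absurd h' (not_le.2 (h₁ _ h))

/-- The point of the Voronoi cell is a nearest neighbour. -/
theorem sq_sub_cell_le (ha : StrictMonoOn a (Set.Iio n)) (hj : j < n) :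
    (x - a (cell n a x)) ^ 2 ≤ (x - a j) ^ 2 := by
  have hlt : cell n a x < n := cell_lt (by omega)
  generalize hc : cell n a x = c at *
  have key : ∀ u v : ℝ, (u - v) * (2 * x - u - v) ≥ 0 → (x - u) ^ 2 ≤ (x - v) ^ 2 := by
    intro u v h
    nlinarith
  apply key
  rcases lt_trichotomy j c with h | h | h
  · obtain ⟨d, rfl⟩ : ∃ d, c = d + 1 := ⟨c - 1, by omega⟩
    have h₁ := (of_lt_cell (n := n) (a := a) (x := x) (i := d) (by omega)).2
    have h₂ : a j ≤ a d := ha.monotoneOn (Set.mem_Iio.2 hj) (Set.mem_Iio.2 (by omega)) (by omega)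
    have h₃ := ha (Set.mem_Iio.2 hj) (Set.mem_Iio.2 hlt) h
    unfold boundary at h₁
    exact mul_nonneg (by linarith) (by linarith)
  · rw [h]
    simp
  · have h₁ : x ≤ boundary a c := hc ▸ (cell_spec n a x).resolve_left (by omega)
    have h₂ : a (c + 1) ≤ a j :=
      ha.monotoneOn (Set.mem_Iio.2 (by omega)) (Set.mem_Iio.2 hj) (by omega)
    have h₃ := ha (Set.mem_Iio.2 hlt) (Set.mem_Iio.2 hj) h
    unfold boundary at h₁
    exact mul_nonneg_of_nonpos_of_nonpos (by linarith) (by linarith)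

end Cell

/-- A bracket: a half slope that is nonpositive at `tl` and positive at `th`, and for every point
`b x`, `x < m`, a range `lo x, …, hi x` of Voronoi cells that contains the cells of `b x + t` for
all `t` between `tl` and `th`. A point with `lo x < hi x` is called active; `S` is the
contribution of the other points to the half slope, without the part that depends on `t`. -/
structure Bracket (n m : ℕ) (a b : ℕ → ℝ) (lo hi : ℕ → ℕ) (tl th S : ℝ) : Prop where
  lo_le : ∀ x < m, lo x ≤ hi x
  hi_lt : ∀ x < m, hi x < n
  low : ∀ x < m, ∀ i < lo x, boundary a i ≤ b x + tl
  high : ∀ x < m, hi x + 1 < n → b x + th ≤ boundary a (hi x)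
  lt : tl < th
  nonpos : halfSlope n m a b tl ≤ 0
  pos : 0 < m → 0 < halfSlope n m a b th
  inactive : S = ∑ x ∈ (Finset.range m).filter (fun x => ¬ lo x < hi x), (b x - a (lo x))

section Bracket

variable {n m : ℕ} {a b : ℕ → ℝ} {lo hi lo' hi' : ℕ → ℕ} {tl th S p : ℝ}

theorem Bracket.congr (h : Bracket n m a b lo hi tl th S) (hlo : ∀ x < m, lo' x = lo x)
    (hhi : ∀ x < m, hi' x = hi x) : Bracket n m a b lo' hi' tl th S := by
  refine ⟨?_, ?_, ?_, ?_, h.lt, h.nonpos, h.pos, ?_⟩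
  · intro x hx
    rw [hlo x hx, hhi x hx]
    exact h.lo_le x hx
  · intro x hx
    rw [hhi x hx]
    exact h.hi_lt x hx
  · intro x hx
    rw [hlo x hx]
    exact h.low x hx
  · intro x hx
    rw [hhi x hx]
    exact h.high x hx
  · rw [h.inactive, Finset.sum_filter, Finset.sum_filter]
    refine Finset.sum_congr rfl fun x hx => ?_
    have hx := Finset.mem_range.1 hx
    rw [hlo x hx, hhi x hx]

/-- In a bracket, the cells lie in their ranges. -/
theorem Bracket.cell_mem (h : Bracket n m a b lo hi tl th S) (h₁ : tl < p) (h₂ : p < th) {x : ℕ}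
    (hx : x < m) : lo x ≤ cell n a (b x + p) ∧ cell n a (b x + p) ≤ hi x := by
  have h₃ := h.lo_le x hx
  have h₄ := h.hi_lt x hx
  constructor
  · by_contra! hc
    have h₅ := h.low x hx _ hc
    have h₆ := (cell_spec n a (b x + p)).resolve_left (by omega)
    linarith
  · by_contra! hc
    obtain ⟨h₅, h₆⟩ := of_lt_cell hc
    have h₇ := h.high x hx h₅
    linarith

/-- In a bracket, only the active points need a search for the evaluation of the half slope. -/
theorem Bracket.halfSlope_eq (h : Bracket n m a b lo hi tl th S) (h₁ : tl < p) (h₂ : p < th) :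
    halfSlope n m a b p = S + m * p +
      ∑ x ∈ (Finset.range m).filter (fun x => lo x < hi x), (b x - a (cell n a (b x + p))) := by
  have e₁ : halfSlope n m a b p =
      m * p + ∑ x ∈ Finset.range m, (b x - a (cell n a (b x + p))) := by
    simp only [halfSlope, Finset.sum_sub_distrib, Finset.sum_add_distrib, Finset.sum_const,
      Finset.card_range, nsmul_eq_mul]
    ring
  have e₂ : S = ∑ x ∈ (Finset.range m).filter (fun x => ¬ lo x < hi x),
      (b x - a (cell n a (b x + p))) := by
    rw [h.inactive]
    refine Finset.sum_congr rfl fun x hx => ?_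
    obtain ⟨hx, hx'⟩ := Finset.mem_filter.1 hx
    have := h.cell_mem h₁ h₂ (Finset.mem_range.1 hx)
    rw [show cell n a (b x + p) = lo x by omega]
  rw [e₁, e₂, ← Finset.sum_filter_add_sum_filter_not (Finset.range m) (fun x => lo x < hi x)]
  ring

theorem Bracket.lower (h : Bracket n m a b lo hi tl th S) (h₁ : tl < p) (h₂ : p < th)
    (hp : halfSlope n m a b p ≤ 0) : Bracket n m a b lo hi p th S :=
  ⟨h.lo_le, h.hi_lt, fun x hx i hi => (h.low x hx i hi).trans (by linarith), h.high, h₂, hp, h.pos,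
    h.inactive⟩

theorem Bracket.upper (h : Bracket n m a b lo hi tl th S) (h₁ : tl < p) (h₂ : p < th)
    (hp : 0 < halfSlope n m a b p) : Bracket n m a b lo hi tl p S :=
  ⟨h.lo_le, h.hi_lt, h.low, fun x hx hi => le_trans (by linarith) (h.high x hx hi), h₁, h.nonpos,
    fun _ => hp, h.inactive⟩

/-- The cell in the middle of the current range. -/
def midCell (lo hi : ℕ → ℕ) (x : ℕ) : ℕ := (lo x + hi x) / 2

/-- The translation that takes `b x` to the boundary in the middle of its current range of Voronoi
cells. -/
noncomputable def pivot (a b : ℕ → ℝ) (lo hi : ℕ → ℕ) (x : ℕ) : ℝ :=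
  boundary a (midCell lo hi x) - b x

/-- The lower end of the range after the half left of the pivot has been discarded, if that is
possible. -/
noncomputable def newLo (a b : ℕ → ℝ) (lo hi : ℕ → ℕ) (tl : ℝ) (x : ℕ) : ℕ :=
  if lo x < hi x ∧ pivot a b lo hi x ≤ tl then midCell lo hi x + 1 else lo x

/-- The upper end of the range after the half right of the pivot has been discarded, if that is
possible. -/
noncomputable def newHi (a b : ℕ → ℝ) (lo hi : ℕ → ℕ) (tl th : ℝ) (x : ℕ) : ℕ :=
  if lo x < hi x ∧ tl < pivot a b lo hi x ∧ th ≤ pivot a b lo hi x then midCell lo hi x else hi x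

theorem Bracket.shrink (ha : StrictMonoOn a (Set.Iio n)) (h : Bracket n m a b lo hi tl th S) :
    Bracket n m a b (newLo a b lo hi tl) (newHi a b lo hi tl th) tl th
      (∑ x ∈ (Finset.range m).filter
        (fun x => ¬ newLo a b lo hi tl x < newHi a b lo hi tl th x),
        (b x - a (newLo a b lo hi tl x))) := by
  refine ⟨?_, ?_, ?_, ?_, h.lt, h.nonpos, h.pos, rfl⟩
  · intro x hx
    have h₁ := h.lo_le x hx
    unfold newLo newHi
    split_ifs with h₂ h₃ h₃
    · exact absurd h₂.2 (not_le.2 h₃.2.1)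
    · unfold midCell
      omega
    · unfold midCell
      omega
    · exact h₁
  · intro x hx
    have h₁ := h.hi_lt x hx
    unfold newHi
    split_ifs with h₃
    · unfold midCell
      omega
    · exact h₁
  · intro x hx i hi'
    have h₁ := h.hi_lt x hx
    unfold newLo at hi'
    split_ifs at hi' with h₂
    · have h₃ : midCell lo hi x + 1 < n := by
        unfold midCell
        omega
      have h₄ := boundary_mono ha (Nat.lt_succ_iff.1 hi') h₃
      have h₅ := h₂.2
      unfold pivot at h₅
      linarith
    · exact h.low x hx i hi'
  · intro x hx hn
    unfold newHi at hn ⊢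
    split_ifs at hn ⊢ with h₂
    · have h₅ := h₂.2.2
      unfold pivot at h₅
      linarith
    · exact h.high x hx hn

theorem size_add_one_le_of_le_half {d e : ℕ} (hd : 0 < d) (h : e ≤ d / 2) :
    Nat.size e + 1 ≤ Nat.size d := by
  refine (Nat.succ_le_succ (Nat.size_le_size h)).trans ?_
  rw [Nat.succ_le_iff, Nat.lt_size]
  obtain h' | h' := Nat.eq_zero_or_pos (d / 2)
  · rw [h']
    simpa using Nat.succ_le_of_lt hd
  · obtain ⟨k, hk⟩ : ∃ k, (d / 2).size = k + 1 := ⟨(d / 2).size - 1, by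
      have := Nat.size_pos.2 h'; omega⟩
    have h'' := Nat.lt_size.1 (show k < (d / 2).size by omega)
    rw [hk, pow_succ]
    omega

/-- Every pivot outside of the bracket pays for one bisection of a range of cells. -/
theorem size_shrink {x : ℕ} (hx : lo x < hi x)
    (h : pivot a b lo hi x ≤ tl ∨ th ≤ pivot a b lo hi x) :
    Nat.size (newHi a b lo hi tl th x - newLo a b lo hi tl x) + 1 ≤ Nat.size (hi x - lo x) := by
  refine size_add_one_le_of_le_half (by omega) ?_
  unfold newLo newHi midCell
  rcases le_or_gt (pivot a b lo hi x) tl with h₁ | h₁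
  · rw [if_neg (fun h₂ => absurd h₁ (not_le.2 h₂.2.1)), if_pos ⟨hx, h₁⟩]
    omega
  · rw [if_pos ⟨hx, h₁, h.resolve_left (not_le.2 h₁)⟩, if_neg (fun h₂ => absurd h₁ (not_lt.2 h₂.2))]
    omega

theorem size_shrink_le (x : ℕ) :
    Nat.size (newHi a b lo hi tl th x - newLo a b lo hi tl x) ≤ Nat.size (hi x - lo x) := by
  by_cases h : lo x < hi x ∧ (pivot a b lo hi x ≤ tl ∨ th ≤ pivot a b lo hi x)
  · exact (Nat.le_succ _).trans (size_shrink h.1 h.2)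
  · unfold newLo newHi
    rw [if_neg (fun h' => h ⟨h'.1, .inr h'.2.2⟩), if_neg (fun h' => h ⟨h'.1, .inl h'.2⟩)]

/-- If no point is active, then the stationary point of the remaining quadratic function is a local
minimum. -/
theorem Bracket.isLocalMin (h : Bracket n m a b lo hi tl th S)
    (ha : StrictMonoOn a (Set.Iio n)) (hl : ∀ x < m, ¬ lo x < hi x) :
    IsLocalMin (fun t => assignedRMS m a b (fun x => cell n a (b x + t)) t) ((0 - S) / m) ∧
      assignedRMS m a b lo ((0 - S) / m) =
        assignedRMS m a b (fun x => cell n a (b x + (0 - S) / m)) ((0 - S) / m) := by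
  -- For `m = 0` the number `(0 - S) / m` is the junk value `0`, but `r` is constant.
  rcases Nat.eq_zero_or_pos m with rfl | hm
  · simp [assignedRMS, IsLocalMin, IsMinFilter]
  have hm' : (0 : ℝ) < m := by exact_mod_cast hm
  have heq : ∀ x < m, lo x = hi x := fun x hx => le_antisymm (h.lo_le x hx) (not_lt.1 (hl x hx))
  have hS : S = ∑ x ∈ Finset.range m, (b x - a (lo x)) := by
    rw [h.inactive, Finset.filter_true_of_mem fun x hx => hl x (Finset.mem_range.1 hx)]
  set t := (0 - S) / m with ht
  have hmt : m * t = -S := by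
    rw [ht]
    field_simp
    ring
  have hsum : ∀ t' : ℝ, ∑ x ∈ Finset.range m, (b x + t' - a (lo x)) = m * t' + S := by
    intro t'
    simp only [hS, Finset.sum_sub_distrib, Finset.sum_add_distrib, Finset.sum_const,
      Finset.card_range, nsmul_eq_mul]
    ring
  -- Between `tl` and `th`, the half slope is `m * t + S`, and this extends to an upper bound at
  -- `th` and to a lower bound at `tl`, so that the zero `t` lies between them.
  have hth : t < th := by
    have h₁ : halfSlope n m a b th ≤ m * th + S := by
      rw [← hsum, halfSlope]
      refine Finset.sum_le_sum fun x hx => ?_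
      have hx := Finset.mem_range.1 hx
      have h₂ : lo x ≤ cell n a (b x + th) := by
        by_contra! hc
        have h₃ := h.hi_lt x hx
        have h₅ := h.low x hx _ hc
        have h₆ := (cell_spec n a (b x + th)).resolve_left (by have := heq x hx; omega)
        have := h.lt
        linarith
      have h₃ : cell n a (b x + th) < n := cell_lt (by have := h.hi_lt x hx; omega)
      have := ha.monotoneOn (Set.mem_Iio.2 (by omega)) (Set.mem_Iio.2 h₃) h₂
      linarith
    have h₂ := h.pos hm
    by_contra! hc
    have := mul_le_mul_of_nonneg_left hc hm'.le
    linarith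
  have hcell_le : ∀ x < m, cell n a (b x + tl) ≤ lo x := by
    intro x hx
    by_contra! hc
    obtain ⟨h₁, h₂⟩ := of_lt_cell hc
    rw [heq x hx] at h₁ h₂
    have h₃ := h.high x hx h₁
    have := h.lt
    linarith
  have hle : ∀ x < m, a (cell n a (b x + tl)) ≤ a (lo x) := fun x hx =>
    ha.monotoneOn (Set.mem_Iio.2 ((hcell_le x hx).trans_lt (by
      rw [heq x hx]; exact h.hi_lt x hx))) (Set.mem_Iio.2 (by rw [heq x hx]; exact h.hi_lt x hx))
      (hcell_le x hx)
  have hsl : m * tl + S ≤ halfSlope n m a b tl := by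
    rw [← hsum, halfSlope]
    refine Finset.sum_le_sum fun x hx => ?_
    have := hle x (Finset.mem_range.1 hx)
    linarith
  have htl : tl ≤ t := by
    have := h.nonpos
    by_contra! hc
    have := mul_lt_mul_of_pos_left hc hm'
    linarith
  -- If `t = tl`, then the half slope vanishes at `tl`, so that no point `b x + tl` is on the
  -- left end of its cell.
  have hleft : ∀ x < m, ∀ i < lo x, boundary a i < b x + t := by
    intro x hx i hi'
    have h₁ := h.low x hx i hi'
    rcases htl.lt_or_eq with h₂ | h₂
    · linarith
    · by_contra! hc
      have h₃ : cell n a (b x + tl) ≤ i := cell_le (.inr (by rw [h₂]; exact hc))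
      have h₄ : a (cell n a (b x + tl)) < a (lo x) :=
        ha (Set.mem_Iio.2 (by have := h.hi_lt x hx; have := heq x hx; omega))
          (Set.mem_Iio.2 (by rw [heq x hx]; exact h.hi_lt x hx)) (by omega)
      have h₅ : m * tl + S < halfSlope n m a b tl := by
        rw [← hsum, halfSlope]
        refine Finset.sum_lt_sum (fun y hy => ?_) ⟨x, Finset.mem_range.2 hx, by linarith⟩
        have := hle y (Finset.mem_range.1 hy)
        linarith
      have := h.nonpos
      rw [h₂] at *
      linarith
  have hright : ∀ x < m, lo x + 1 < n → b x + t < boundary a (lo x) := by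
    intro x hx hn
    rw [heq x hx] at hn ⊢
    have := h.high x hx hn
    linarith
  have hnear : ∀ᶠ t' in nhds t, ∀ x ∈ Finset.range m, cell n a (b x + t') = lo x := by
    rw [Filter.eventually_all_finset]
    intro x hx
    have hx := Finset.mem_range.1 hx
    have h₁ : ∀ᶠ t' in nhds t, ∀ i ∈ Finset.range (lo x), boundary a i < b x + t' := by
      rw [Filter.eventually_all_finset]
      intro i hi'
      exact (continuous_const.add continuous_id).continuousAt.eventually_const_lt
        (hleft x hx i (Finset.mem_range.1 hi'))
    have h₂ : ∀ᶠ t' in nhds t, lo x + 1 < n → b x + t' < boundary a (lo x) := by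
      by_cases hn : lo x + 1 < n
      · filter_upwards [(continuous_const.add continuous_id).continuousAt.eventually_lt_const
          (hright x hx hn)] with t' ht' _ using ht'
      · exact .of_forall fun _ h => absurd h hn
    filter_upwards [h₁, h₂] with t' h₃ h₄
    exact cell_eq (by rw [heq x hx]; exact h.hi_lt x hx)
      (fun i hi' => h₃ i (Finset.mem_range.2 hi')) fun hn => (h₄ hn).le
  have hval : ∀ t', (∀ x ∈ Finset.range m, cell n a (b x + t') = lo x) →
      assignedRMS m a b (fun x => cell n a (b x + t')) t' = assignedRMS m a b lo t' := by
    intro t' ht'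
    refine Finset.sum_congr rfl fun x hx => ?_
    simp only [ht' x hx]
  refine ⟨?_, (hval t hnear.self_of_nhds).symm⟩
  filter_upwards [hnear] with t' ht'
  rw [hval t' ht', hval t hnear.self_of_nhds]
  have h₀ : ∑ x ∈ Finset.range m, (b x + t - a (lo x)) = 0 := by
    rw [hsum]
    linarith
  have e : assignedRMS m a b lo t' = assignedRMS m a b lo t +
      2 * (t' - t) * ∑ x ∈ Finset.range m, (b x + t - a (lo x)) + m * (t' - t) ^ 2 := by
    rw [Finset.mul_sum, assignedRMS, assignedRMS, ← Finset.sum_add_distrib,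
      show (m : ℝ) * (t' - t) ^ 2 = ∑ x ∈ Finset.range m, (t' - t) ^ 2 by simp,
      ← Finset.sum_add_distrib]
    exact Finset.sum_congr rfl fun x _ => by ring
  rw [e, h₀]
  have : 0 ≤ (m : ℝ) * (t' - t) ^ 2 := by positivity
  linarith

end Bracket

/-- The RMS distance under translation in terms of Voronoi cells. -/
theorem rmsUnderTranslation_eq {n m : ℕ} (A : Fin n → ℝ) (B : Fin m → ℝ) (a b : ℕ → ℝ)
    (hA : ∀ i : Fin n, a i = A i) (hB : ∀ i : Fin m, b i = B i) (hn : 0 < n)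
    (ha : StrictMonoOn a (Set.Iio n)) (hinj : Function.Injective B) (t : ℝ) :
    rmsUnderTranslation (Finset.univ.image B) (Finset.univ.image A) t =
      assignedRMS m a b (fun x => cell n a (b x + t)) t := by
  rw [rmsUnderTranslation, hausdorffRMS, translateBy, Finset.sum_map,
    Finset.sum_image hinj.injOn, assignedRMS, Finset.sum_range]
  refine Finset.sum_congr rfl fun x _ => ?_
  simp only [addRightEmbedding_apply, hB, Real.norm_eq_abs, sq_abs]
  have hne : (Finset.univ.image A).Nonempty := ⟨A ⟨0, hn⟩, by simp⟩
  apply le_antisymm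
  · have hmem : A ⟨cell n a (B x + t), cell_lt hn⟩ ∈ Finset.univ.image A := by simp
    have := norm_sub_nearestNeighbor_le (B x + t) hmem
    rw [← hA] at this
    exact sq_le_sq.2 this
  · obtain ⟨j, -, hj⟩ := Finset.mem_image.1 (nearestNeighbor_mem hne (B x + t))
    rw [← hj, ← hA]
    exact sq_sub_cell_le ha j.2

/-! ### Evaluating the half slope -/

/-- The list of the active points: the first `natReg 2` entries of the array `2`. -/
def actives (s : Store) : List ℕ := (List.range (s.natReg 2)).map (s.natArr 2)

/-- The list `l` enumerates the points `x < m` with `lo x < hi x` without repetitions. -/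
structure IsActiveList (m : ℕ) (lo hi : ℕ → ℕ) (l : List ℕ) : Prop where
  nodup : l.Nodup
  mem_iff : ∀ x, x ∈ l ↔ x < m ∧ lo x < hi x

/-- The input is stored in its place: the lengths `n` and `m` in the natural-number registers `0`
and `1`, the points in the real arrays `0` and `1`. -/
structure Env (n m : ℕ) (a b : ℕ → ℝ) (s : Store) : Prop where
  n_eq : s.natReg 0 = n
  m_eq : s.natReg 1 = m
  a_eq : s.realArr 0 = a
  b_eq : s.realArr 1 = b

/-- The invariant of the prune-and-search loop. The ranges of cells are in the natural-number
arrays `0` and `1`, the active points in the array `2`; the ends of the bracket and the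
contribution of the inactive points are in the real registers `2`, `3` and `4`. -/
structure Inv (n m : ℕ) (a b : ℕ → ℝ) (s : Store) : Prop where
  env : Env n m a b s
  bracket : Bracket n m a b (s.natArr 0) (s.natArr 1) (s.realReg 2) (s.realReg 3) (s.realReg 4)
  active : IsActiveList m (s.natArr 0) (s.natArr 1) (actives s)

/-- The number of bisections that the ranges of cells of the points `x < m` admit. -/
def potential (m : ℕ) (lo hi : ℕ → ℕ) : ℕ := ∑ x ∈ Finset.range m, Nat.size (hi x - lo x)

theorem sum_map_range {M : Type*} [AddCommMonoid M] (f : ℕ → M) (k : ℕ) :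
    ((List.range k).map f).sum = ∑ u ∈ Finset.range k, f u := by
  induction k with
  | zero => simp
  | succ k ih =>
    rw [List.range_succ, List.map_append, List.sum_append, ih, Finset.sum_range_succ]
    simp

theorem IsActiveList.sum_eq {M : Type*} [AddCommMonoid M] {m : ℕ} {lo hi : ℕ → ℕ} {l : List ℕ}
    (h : IsActiveList m lo hi l) (f : ℕ → M) :
    (l.map f).sum = ∑ x ∈ (Finset.range m).filter (fun x => lo x < hi x), f x := by
  rw [← List.sum_toFinset f h.nodup]
  refine Finset.sum_congr ?_ fun _ _ => rfl
  ext x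
  simp [h.mem_iff]

/-- Add the point `natReg 4` to the active points (there are `natReg 6` of them so far), or to the
contribution `realReg 4` of the inactive ones, as its range of cells demands. -/
def push : Cmd :=
  .ite (.natLt (.read 0 (.reg 4)) (.read 1 (.reg 4)))
    (.block [.writeNat 2 (.reg 6) (.reg 4), .setNat 6 (.add (.reg 6) (.const 1))])
    (.setReal 4 (.add (.reg 4) (.sub (.read 1 (.reg 4)) (.read 0 (.read 0 (.reg 4))))))

/-- The final store `s'` after `push` on `s`. -/
structure PushSpec (s s' : Store) : Prop where
  natReg : ∀ y ≠ 6, s'.natReg y = s.natReg y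
  realReg : ∀ y ≠ 4, s'.realReg y = s.realReg y
  realArr : s'.realArr = s.realArr
  lo : s'.natArr 0 = s.natArr 0
  hi : s'.natArr 1 = s.natArr 1
  count : s'.natReg 6 ≤ s.natReg 6 + 1
  rest : ∀ u ≠ s.natReg 6, s'.natArr 2 u = s.natArr 2 u
  list : ∀ (l : List ℕ) (P : ℕ → Bool),
    P (s.natReg 4) = decide (s.natArr 0 (s.natReg 4) < s.natArr 1 (s.natReg 4)) →
    (List.range (s.natReg 6)).map (s.natArr 2) = l.filter P →
    (List.range (s'.natReg 6)).map (s'.natArr 2) = (l ++ [s.natReg 4]).filter P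
  sum : ∀ (S₀ : ℝ) (f : ℕ → ℝ) (l : List ℕ) (P : ℕ → Bool),
    P (s.natReg 4) = decide (s.natArr 0 (s.natReg 4) < s.natArr 1 (s.natReg 4)) →
    f (s.natReg 4) = s.realArr 1 (s.natReg 4) - s.realArr 0 (s.natArr 0 (s.natReg 4)) →
    s.realReg 4 = S₀ + ((l.filter fun x => !P x).map f).sum →
    s'.realReg 4 = S₀ + (((l ++ [s.natReg 4]).filter fun x => !P x).map f).sum

theorem wp_push (procs : List Cmd) (s : Store) :
    Wp procs push s fun T s' => T ≤ 30 ∧ PushSpec s s' := by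
  rw [push, wp_ite]
  constructor
  · intro h
    simp only [Test.Holds, NatExpr.eval] at h
    simp only [wp_block_cons, wp_block_one, wp_writeNat, wp_setNat]
    refine ⟨by simp, ⟨?_, ?_, ?_, ?_, ?_, ?_, ?_, ?_, ?_⟩⟩
    · intro y hy
      simp [hy]
    · simp
    · simp
    · simp
    · simp
    · simp
    · intro u hu
      simp [hu]
    · intro l P hP hl
      rw [decide_eq_true h] at hP
      simp only [natReg_setNat, natArr_setNat, natArr_writeNat, if_true, NatExpr.eval,
        natReg_writeNat]
      rw [List.range_succ, List.map_append, List.filter_append, ← hl]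
      congr 1
      · refine List.map_congr_left fun u hu => ?_
        rw [Function.update_of_ne (by have := List.mem_range.1 hu; omega)]
      · simp [hP]
    · intro S₀ f l P hP hf hS
      rw [decide_eq_true h] at hP
      simp [hP, hS]
  · intro h
    simp only [Test.Holds, NatExpr.eval] at h
    rw [wp_setReal]
    refine ⟨by simp, ⟨?_, ?_, ?_, ?_, ?_, ?_, ?_, ?_, ?_⟩⟩
    · simp
    · intro y hy
      simp [hy]
    · simp
    · simp
    · simp
    · simp
    · simp
    · intro l P hP hl
      rw [decide_eq_false h] at hP
      simp [hP, hl]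
    · intro S₀ f l P hP hf hS
      rw [decide_eq_false h] at hP
      simp [hP, hS, hf, add_assoc]

/-- The boundary after the cell with the index `i`, as an expression. -/
def boundaryExpr (i : NatExpr) : RealExpr :=
  .div (.add (.read 0 i) (.read 0 (.add i (.const 1)))) (.const 2)

theorem eval_boundaryExpr (s : Store) (i : NatExpr) :
    (boundaryExpr i).eval s = boundary (s.realArr 0) (i.eval s) := by
  simp [boundaryExpr, boundary]

/-- Binary search: store the cell of the number `realReg 7` in `natReg 7`. -/
def search : Cmd :=
  .block [
    .setNat 7 (.const 0),
    .setNat 8 (.sub (.reg 0) (.const 1)),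
    .while (.natLt (.reg 7) (.reg 8)) (.block [
      .setNat 9 (.half (.add (.reg 7) (.reg 8))),
      .ite (.realLt (boundaryExpr (.reg 9)) (.reg 7))
        (.setNat 7 (.add (.reg 9) (.const 1)))
        (.setNat 8 (.reg 9))])]

theorem wp_search (procs : List Cmd) {n m : ℕ} {a b : ℕ → ℝ} (hn : 0 < n)
    (ha : StrictMonoOn a (Set.Iio n)) (s : Store) (hs : Env n m a b s) :
    Wp procs search s fun T s' => T ≤ 40 * Nat.size n + 40 ∧
      (∀ y < 7, s'.natReg y = s.natReg y) ∧ s'.realReg = s.realReg ∧ s'.natArr = s.natArr ∧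
      s'.realArr = s.realArr ∧ s'.natReg 7 = cell n a (s.realReg 7) := by
  simp only [search, wp_block_cons, wp_block_one, wp_setNat]
  refine (wp_while (fun Φ s' => (∀ y < 7, s'.natReg y = s.natReg y) ∧ s'.realReg = s.realReg ∧
      s'.natArr = s.natArr ∧ s'.realArr = s.realArr ∧ s'.natReg 7 ≤ s'.natReg 8 ∧
      s'.natReg 8 < n ∧ (∀ i < s'.natReg 7, boundary a i < s.realReg 7) ∧
      (s'.natReg 8 + 1 < n → s.realReg 7 ≤ boundary a (s'.natReg 8)) ∧
      Φ = 40 * Nat.size (s'.natReg 8 - s'.natReg 7)) ?_ (40 * Nat.size (n - 1)) ?_).mono ?_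
  · rintro _ s' ⟨h1, h2, h3, h4, h5, h6, h7, h8, rfl⟩ hp
    simp only [Test.Holds, NatExpr.eval] at hp
    simp only [wp_block_cons, wp_block_one, wp_setNat, wp_ite, Test.Holds, eval_boundaryExpr]
    have ea : s'.realArr 0 = a := by rw [h4, hs.a_eq]
    constructor
    · intro hq
      refine ⟨_, ⟨?_, h2, h3, h4, ?_, ?_, ?_, ?_, rfl⟩, ?_⟩
      · intro y hy
        have h7 : y ≠ 7 := by omega
        have h9 : y ≠ 9 := by omega
        simp [h7, h9, h1 y hy]
      · simp
        omega
      · simpa using h6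
      · simp [ea, h2] at hq
        simp
        intro i hi
        exact (boundary_mono ha (by omega) (by omega)).trans_lt hq
      · simpa using h8
      · have := size_add_one_le_of_le_half (d := s'.natReg 8 - s'.natReg 7)
          (e := s'.natReg 8 - ((s'.natReg 7 + s'.natReg 8) / 2 + 1)) (by omega) (by omega)
        simp [boundaryExpr]
        omega
    · intro hq
      refine ⟨_, ⟨?_, h2, h3, h4, ?_, ?_, ?_, ?_, rfl⟩, ?_⟩
      · intro y hy
        have h8 : y ≠ 8 := by omega
        have h9 : y ≠ 9 := by omega
        simp [h8, h9, h1 y hy]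
      · simp
        omega
      · simp
        omega
      · simpa using h7
      · simp [ea, h2] at hq
        simp [hq]
      · have := size_add_one_le_of_le_half (d := s'.natReg 8 - s'.natReg 7)
          (e := (s'.natReg 7 + s'.natReg 8) / 2 - s'.natReg 7) (by omega) (by omega)
        simp [boundaryExpr]
        omega
  · refine ⟨?_, rfl, rfl, rfl, ?_, ?_, ?_, ?_, ?_⟩
    · intro y hy
      have h7 : y ≠ 7 := by omega
      have h8 : y ≠ 8 := by omega
      simp [h7, h8]
    · simp
    · simp [hs.n_eq]
      omega
    · simp
    · simp [hs.n_eq]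
      omega
    · simp [hs.n_eq]
  · rintro T s' ⟨hT, _, ⟨h1, h2, h3, h4, h5, h6, h7, h8, -⟩, hp⟩
    simp only [Test.Holds, NatExpr.eval] at hp
    have e : s'.natReg 7 = s'.natReg 8 := by omega
    refine ⟨?_, h1, h2, h3, h4, (cell_eq (by omega) h7 (by rwa [e])).symm⟩
    have := Nat.size_le_size (Nat.sub_le n 1)
    simp at hT ⊢
    omega

/-- Evaluate the half slope at `realReg 5`, and move one end of the bracket there. -/
def evaluate : Cmd :=
  .block [
    .setReal 6 (.add (.reg 4) (.mul (.ofNat (.reg 1)) (.reg 5))),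
    .setNat 3 (.const 0),
    .while (.natLt (.reg 3) (.reg 2)) (.block [
      .setReal 7 (.add (.read 1 (.read 2 (.reg 3))) (.reg 5)),
      search,
      .setReal 6 (.add (.reg 6) (.sub (.read 1 (.read 2 (.reg 3))) (.read 0 (.reg 7)))),
      .setNat 3 (.add (.reg 3) (.const 1))]),
    .ite (.realLt (.const 0) (.reg 6)) (.setReal 3 (.reg 5)) (.setReal 2 (.reg 5))]

theorem wp_evaluate (procs : List Cmd) {n m : ℕ} {a b : ℕ → ℝ} (hn : 0 < n)
    (ha : StrictMonoOn a (Set.Iio n)) (s : Store) (hs : Inv n m a b s)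
    (h₁ : s.realReg 2 < s.realReg 5) (h₂ : s.realReg 5 < s.realReg 3) :
    Wp procs evaluate s fun T s' => T ≤ s.natReg 2 * (40 * Nat.size n + 90) + 90 ∧
      Inv n m a b s' ∧ s'.natReg 2 = s.natReg 2 ∧ s'.natArr = s.natArr ∧
      s'.realReg 5 = s.realReg 5 ∧
      (s'.realReg 5 ≤ s'.realReg 2 ∨ s'.realReg 3 ≤ s'.realReg 5) := by
  simp only [evaluate, wp_block_cons, wp_block_one, wp_setNat, wp_setReal]
  set p := s.realReg 5 with hp
  refine (wp_for (fun j s' => (∀ y < 3, s'.natReg y = s.natReg y) ∧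
      (∀ y < 6, s'.realReg y = s.realReg y) ∧ s'.natArr = s.natArr ∧
      s'.realArr = s.realArr ∧ s'.natReg 3 = j ∧
      s'.realReg 6 = s.realReg 4 + m * p + ∑ u ∈ Finset.range j,
        (b (s.natArr 2 u) - a (cell n a (b (s.natArr 2 u) + p))))
      (s.natReg 2) (40 * Nat.size n + 80) ?_ ?_ ?_).mono ?_
  · rintro j s' ⟨h1, h2, h3, h4, h5, h6⟩
    simp [h1, h5]
  · rintro j s' hj ⟨h1, h2, h3, h4, h5, h6⟩
    simp only [wp_block_cons, wp_block_one, wp_setReal, wp_setNat]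
    refine (wp_search procs hn ha _ (m := m) (b := b) ⟨?_, ?_, ?_, ?_⟩).mono ?_
    · simp [h1, hs.env.n_eq]
    · simp [h1, hs.env.m_eq]
    · simp [h4, hs.env.a_eq]
    · simp [h4, hs.env.b_eq]
    · rintro T s₁ ⟨hT, k1, k2, k3, k4, k5⟩
      simp only [natReg_setReal, natArr_setReal, realArr_setReal] at k1 k3 k4
      have e3 : s₁.natReg 3 = j := by rw [k1 3 (by omega), h5]
      have e6 : s₁.realReg 6 = s'.realReg 6 := by simp [k2]
      refine ⟨?_, ?_, ?_, ?_, ?_, ?_, ?_⟩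
      · simp
        omega
      · intro y hy
        have h3 : y ≠ 3 := by omega
        simp [h3, k1 y (by omega), h1 y hy]
      · intro y hy
        have h6 : y ≠ 6 := by omega
        have h7 : y ≠ 7 := by omega
        simp [h6, k2, h7, h2 y hy]
      · simp [k3, h3]
      · simp [k4, h4]
      · simp [e3]
      · simp [e3, e6, h6, k3, h3, k4, h4, hs.env.b_eq, hs.env.a_eq, k5, h5, h2, ← hp,
          Finset.sum_range_succ]
        ring
  · refine ⟨?_, ?_, rfl, rfl, ?_, ?_⟩
    · intro y hy
      have h3 : y ≠ 3 := by omega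
      simp [h3]
    · intro y hy
      have h6 : y ≠ 6 := by omega
      simp [h6]
    · simp
    · simp [hs.env.m_eq, ← hp]
  · rintro T s' ⟨hT, h1, h2, h3, h4, h5, h6⟩
    have e6 : s'.realReg 6 = halfSlope n m a b p := by
      rw [h6, hs.bracket.halfSlope_eq h₁ h₂, ← hs.active.sum_eq, actives, List.map_map,
        sum_map_range]
      rfl
    have hT' : ∀ c ≤ 40, c + T ≤ s.natReg 2 * (40 * Nat.size n + 90) + 90 := by
      intro c hc
      have : s.natReg 2 * (40 * Nat.size n + 80 + 3 + 1) ≤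
        s.natReg 2 * (40 * Nat.size n + 90) := Nat.mul_le_mul_left _ (by omega)
      simp at hT
      omega
    have henv : Env n m a b s' := ⟨by rw [h1 0 (by omega), hs.env.n_eq],
      by rw [h1 1 (by omega), hs.env.m_eq], by rw [h4, hs.env.a_eq], by rw [h4, hs.env.b_eq]⟩
    have hact : actives s' = actives s := by rw [actives, actives, h3, h1 2 (by omega)]
    rw [wp_ite]
    simp only [wp_setReal]
    constructor
    · intro hpos
      simp [e6] at hpos
      refine ⟨by have := hT' 20 (by omega); simp; omega, ⟨⟨?_, ?_, ?_, ?_⟩, ?_, ?_⟩, ?_, ?_, ?_, ?_⟩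
      · simp [henv.n_eq]
      · simp [henv.m_eq]
      · simp [henv.a_eq]
      · simp [henv.b_eq]
      · simpa [h3, h2, ← hp] using hs.bracket.upper h₁ h₂ hpos
      · simpa [h3, actives, h1] using hs.active
      · simp [h1]
      · simp [h3]
      · simp [h2, ← hp]
      · right
        simp
    · intro hneg
      simp [e6] at hneg
      refine ⟨by have := hT' 20 (by omega); simp; omega, ⟨⟨?_, ?_, ?_, ?_⟩, ?_, ?_⟩, ?_, ?_, ?_, ?_⟩
      · simp [henv.n_eq]
      · simp [henv.m_eq]
      · simp [henv.a_eq]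
      · simp [henv.b_eq]
      · simpa [h3, h2, ← hp] using hs.bracket.lower h₁ h₂ hneg
      · simpa [h3, actives, h1] using hs.active
      · simp [h1]
      · simp [h3]
      · simp [h2, ← hp]
      · left
        simp

/-! ### Pruning the ranges of cells -/

/-- Discard one half of the range of cells of the `natReg 3`-th active point, if its pivot is
outside of the bracket. -/
def bisect : Cmd :=
  .block [
    .setNat 4 (.read 2 (.reg 3)),
    .setNat 5 (.half (.add (.read 0 (.reg 4)) (.read 1 (.reg 4)))),
    .setReal 7 (.sub (boundaryExpr (.reg 5)) (.read 1 (.reg 4))),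
    .ite (.not (.realLt (.reg 2) (.reg 7)))
      (.writeNat 0 (.reg 4) (.add (.reg 5) (.const 1)))
      (.ite (.not (.realLt (.reg 7) (.reg 3))) (.writeNat 1 (.reg 4) (.reg 5)) .skip)]

theorem wp_bisect (procs : List Cmd) (s : Store) (x : ℕ) (hx : s.natArr 2 (s.natReg 3) = x)
    (hlt : s.natArr 0 x < s.natArr 1 x) :
    Wp procs bisect s fun T s' => T ≤ 60 ∧ (∀ y ≠ 4, y ≠ 5 → s'.natReg y = s.natReg y) ∧
      s'.natReg 4 = x ∧ (∀ y ≠ 7, s'.realReg y = s.realReg y) ∧ s'.realArr = s.realArr ∧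
      s'.natArr 2 = s.natArr 2 ∧
      s'.natArr 0 = Function.update (s.natArr 0) x (newLo (s.realArr 0) (s.realArr 1)
        (s.natArr 0) (s.natArr 1) (s.realReg 2) x) ∧
      s'.natArr 1 = Function.update (s.natArr 1) x (newHi (s.realArr 0) (s.realArr 1)
        (s.natArr 0) (s.natArr 1) (s.realReg 2) (s.realReg 3) x) := by
  simp only [bisect, wp_block_cons, wp_block_one, wp_setNat, wp_setReal,
    wp_ite, wp_writeNat, wp_skip]
  have key : boundary (s.realArr 0) ((s.natArr 0 x + s.natArr 1 x) / 2) - s.realArr 1 x =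
      pivot (s.realArr 0) (s.realArr 1) (s.natArr 0) (s.natArr 1) x := rfl
  have regs : ∀ y ≠ 4, y ≠ 5 → ∀ v w : ℕ, ((s.setNat 4 v).setNat 5 w).natReg y = s.natReg y := by
    intro y h4 h5 v w
    simp [h4, h5]
  refine ⟨fun h => ?_, fun h => ⟨fun h' => ?_, fun h' => ?_⟩⟩
  · simp [hx, eval_boundaryExpr, key] at h
    refine ⟨by simp [boundaryExpr], fun y h4 h5 => regs y h4 h5 _ _, by simp [hx],
      fun y hy => by simp [hy], by simp, by simp, ?_, ?_⟩
    · simp [hx, newLo, hlt, h, midCell]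
    · simp [newHi, not_lt.2 h]
  · simp [hx, eval_boundaryExpr, key] at h h'
    refine ⟨by simp [boundaryExpr], fun y h4 h5 => regs y h4 h5 _ _, by simp [hx],
      fun y hy => by simp [hy], by simp, by simp, ?_, ?_⟩
    · simp [newLo, not_le.2 h]
    · simp [hx, newHi, hlt, h, h', midCell]
  · simp [hx, eval_boundaryExpr, key] at h h'
    refine ⟨by simp [boundaryExpr], fun y h4 h5 => regs y h4 h5 _ _, by simp [hx],
      fun y hy => by simp [hy], by simp, by simp, ?_, ?_⟩
    · simp [newLo, not_le.2 h]
    · simp [newHi, not_le.2 h']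

/-- Discard what is possible of the ranges of cells, and remove the points that are not active any
more from the list. -/
def update : Cmd :=
  .block [
    .setNat 3 (.const 0),
    .setNat 6 (.const 0),
    .while (.natLt (.reg 3) (.reg 2)) (.block [
      bisect, push, .setNat 3 (.add (.reg 3) (.const 1))]),
    .setNat 2 (.reg 6)]

theorem wp_update (procs : List Cmd) {n m : ℕ} {a b : ℕ → ℝ} (ha : StrictMonoOn a (Set.Iio n))
    (s : Store) (hs : Inv n m a b s) :
    Wp procs update s fun T s' => T ≤ s.natReg 2 * 120 + 20 ∧ Inv n m a b s' ∧
      ∀ x < m, s'.natArr 0 x = newLo a b (s.natArr 0) (s.natArr 1) (s.realReg 2) x ∧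
        s'.natArr 1 x = newHi a b (s.natArr 0) (s.natArr 1) (s.realReg 2) (s.realReg 3) x := by
  simp only [update, wp_block_cons, wp_block_one, wp_setNat]
  set lo := s.natArr 0 with hlo
  set hi := s.natArr 1 with hhi
  set act := s.natArr 2 with hact
  set k := s.natReg 2 with hk
  set nl := newLo a b lo hi (s.realReg 2) with hnl
  set nh := newHi a b lo hi (s.realReg 2) (s.realReg 3) with hnh
  set P : ℕ → Bool := fun x => decide (nl x < nh x) with hP
  set f : ℕ → ℝ := fun x => b x - a (nl x) with hf
  have hmem : ∀ j < k, act j < m ∧ lo (act j) < hi (act j) := fun j hj =>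
    (hs.active.mem_iff _).1 (List.mem_map_of_mem (List.mem_range.2 hj))
  have hinj : ∀ i < k, ∀ j < k, act i = act j → i = j := fun i hi j hj h =>
    List.inj_on_of_nodup_map hs.active.nodup (List.mem_range.2 hi) (List.mem_range.2 hj) h
  refine (wp_for (fun j s' => j ≤ k ∧ Env n m a b s' ∧ s'.natReg 2 = k ∧ s'.natReg 3 = j ∧
      s'.natReg 6 ≤ j ∧ s'.realReg 2 = s.realReg 2 ∧ s'.realReg 3 = s.realReg 3 ∧
      (∀ u, j ≤ u → s'.natArr 2 u = act u) ∧
      (∀ x, s'.natArr 0 x = if x ∈ (List.range j).map act then nl x else lo x) ∧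
      (∀ x, s'.natArr 1 x = if x ∈ (List.range j).map act then nh x else hi x) ∧
      (List.range (s'.natReg 6)).map (s'.natArr 2) = ((List.range j).map act).filter P ∧
      s'.realReg 4 = s.realReg 4 + ((((List.range j).map act).filter fun x => !P x).map f).sum)
      k 110 ?_ ?_ ?_).mono ?_
  · rintro j s' ⟨-, -, h2, h3, -⟩
    simp [h2, h3]
  · rintro j s' hj ⟨-, henv, h2, h3, h6, r2, r3, hrest, hl, hh, hlist, hsum⟩
    have hx : s'.natArr 2 (s'.natReg 3) = act j := by rw [h3, hrest j le_rfl]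
    have hnm : act j ∉ (List.range j).map act := by
      intro h
      obtain ⟨i, hi, hij⟩ := List.mem_map.1 h
      have hi := List.mem_range.1 hi
      have := hinj i (by omega) j hj hij
      omega
    have e0 : s'.natArr 0 (act j) = lo (act j) := by rw [hl, if_neg hnm]
    have e1 : s'.natArr 1 (act j) = hi (act j) := by rw [hh, if_neg hnm]
    simp only [wp_block_cons, wp_block_one, wp_setNat]
    refine (wp_bisect procs s' (act j) hx (by rw [e0, e1]; exact (hmem j hj).2)).mono ?_
    rintro T₁ s₁ ⟨hT₁, k1, k2, k3, k4, k5, k6, k7⟩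
    have enl : newLo (s'.realArr 0) (s'.realArr 1) (s'.natArr 0) (s'.natArr 1) (s'.realReg 2)
        (act j) = nl (act j) := by
      simp [newLo, pivot, midCell, hnl, henv.a_eq, henv.b_eq, e0, e1, r2]
    have enh : newHi (s'.realArr 0) (s'.realArr 1) (s'.natArr 0) (s'.natArr 1) (s'.realReg 2)
        (s'.realReg 3) (act j) = nh (act j) := by
      simp only [newHi, pivot, midCell, hnh, henv.a_eq, henv.b_eq, e0, e1, r2, r3]
      exact if_congr Iff.rfl rfl rfl
    rw [enl] at k6
    rw [enh] at k7
    refine (wp_push procs s₁).mono ?_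
    rintro T₂ s₂ ⟨hT₂, h₂⟩
    have hPx : P (s₁.natReg 4) =
        decide (s₁.natArr 0 (s₁.natReg 4) < s₁.natArr 1 (s₁.natReg 4)) := by
      simp [k2, k6, k7, hP]
    have e6 : s₁.natReg 6 = s'.natReg 6 := k1 6 (by omega) (by omega)
    have hsucc : (List.range (j + 1)).map act = (List.range j).map act ++ [act j] := by
      simp [List.range_succ]
    refine ⟨?_, hj, ⟨?_, ?_, ?_, ?_⟩, ?_, ?_, ?_, ?_, ?_, ?_, ?_, ?_, ?_, ?_⟩
    · simp
      omega
    · simp [h₂.natReg, k1, henv.n_eq]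
    · simp [h₂.natReg, k1, henv.m_eq]
    · simp [h₂.realArr, k4, henv.a_eq]
    · simp [h₂.realArr, k4, henv.b_eq]
    · simp [h₂.natReg, k1, h2]
    · simp [h₂.natReg, k1, h3]
    · have := h₂.count
      simp
      omega
    · simp [h₂.realReg, k3, r2]
    · simp [h₂.realReg, k3, r3]
    · intro u hu
      simp [h₂.rest u (by omega), k5, hrest u (by omega)]
    · intro x
      rw [hsucc]
      simp only [natArr_setNat, h₂.lo, k6, Function.update_apply, hl, List.mem_append,
        List.mem_singleton]
      by_cases hx : x = act j
      · simp [hx]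
      · simp [hx]
    · intro x
      rw [hsucc]
      simp only [natArr_setNat, h₂.hi, k7, Function.update_apply, hh, List.mem_append,
        List.mem_singleton]
      by_cases hx : x = act j
      · simp [hx]
      · simp [hx]
    · rw [hsucc]
      have := h₂.list ((List.range j).map act) P hPx (by rw [e6, k5, hlist])
      rw [k2] at this
      simpa using this
    · rw [hsucc]
      have := h₂.sum (s.realReg 4) f ((List.range j).map act) P hPx
        (by simp [k2, k4, k6, hf, henv.a_eq, henv.b_eq]) (by rw [k3 4 (by omega), hsum])
      rw [k2] at this
      simpa using this
  · refine ⟨Nat.zero_le _, ⟨?_, ?_, ?_, ?_⟩, ?_⟩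
    · simp [hs.env.n_eq]
    · simp [hs.env.m_eq]
    · simp [hs.env.a_eq]
    · simp [hs.env.b_eq]
    · simp [← hlo, ← hhi, ← hact, ← hk]
  · rintro T s' ⟨hT, -, henv, h2, h3, h6, r2, r3, hrest, hl, hh, hlist, hsum⟩
    have hl' : ∀ x < m, s'.natArr 0 x = nl x := by
      intro x hx
      rw [hl]
      split_ifs with h
      · rfl
      · have : ¬ lo x < hi x := fun h' => h ((hs.active.mem_iff x).2 ⟨hx, h'⟩)
        simp [hnl, newLo, this]
    have hh' : ∀ x < m, s'.natArr 1 x = nh x := by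
      intro x hx
      rw [hh]
      split_ifs with h
      · rfl
      · have : ¬ lo x < hi x := fun h' => h ((hs.active.mem_iff x).2 ⟨hx, h'⟩)
        simp [hnh, newHi, this]
    have hsub : ∀ x, nl x < nh x → lo x < hi x := by
      intro x hx
      by_contra h
      simp [hnl, hnh, newLo, newHi, h] at hx
    refine ⟨?_, ⟨⟨?_, ?_, ?_, ?_⟩, ?_, ⟨?_, ?_⟩⟩, ?_⟩
    · simp at hT ⊢
      omega
    · simp [henv.n_eq]
    · simp [henv.m_eq]
    · simp [henv.a_eq]
    · simp [henv.b_eq]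
    · have hbr := hs.bracket.shrink ha
      have hS : s'.realReg 4 = ∑ x ∈ (Finset.range m).filter (fun x => ¬ nl x < nh x), f x := by
        rw [hsum, hs.bracket.inactive]
        have e : ((List.range k).map act).filter (fun x => !P x) =
            (actives s).filter fun x => !P x := rfl
        rw [e, ← List.sum_toFinset f (hs.active.nodup.filter _)]
        have e₁ : ((actives s).filter fun x => !P x).toFinset = ((Finset.range m).filter
            (fun x => ¬ nl x < nh x)).filter (fun x => lo x < hi x) := by
          ext x
          simp only [List.mem_toFinset, List.mem_filter, hs.active.mem_iff, Finset.mem_filter,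
            Finset.mem_range, hP, Bool.not_eq_true', decide_eq_false_iff_not]
          tauto
        have e₂ : ∑ x ∈ (Finset.range m).filter (fun x => ¬ lo x < hi x), (b x - a (lo x)) =
            ∑ x ∈ ((Finset.range m).filter (fun x => ¬ nl x < nh x)).filter
              (fun x => ¬ lo x < hi x), f x := by
          refine Finset.sum_congr ?_ fun x hx => ?_
          · ext x
            simp only [Finset.mem_filter]
            have := hsub x
            tauto
          · have := (Finset.mem_filter.1 hx).2
            simp [hf, hnl, newLo, this]
        rw [e₁, e₂, add_comm, Finset.sum_filter_add_sum_filter_not]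
      simp only [natArr_setNat, realReg_setNat, r2, r3, hS]
      exact hbr.congr hl' hh'
    · simp only [actives, natArr_setNat, natReg_setNat, if_true, NatExpr.eval]
      rw [hlist]
      exact hs.active.nodup.filter _
    · intro x
      simp only [actives, natArr_setNat, natReg_setNat, if_true, NatExpr.eval]
      rw [hlist, List.mem_filter]
      have e := hs.active.mem_iff x
      rw [show (List.range k).map act = actives s from rfl, e]
      constructor
      · rintro ⟨⟨hx, -⟩, h⟩
        rw [hl' x hx, hh' x hx]
        exact ⟨hx, by simpa [hP] using h⟩
      · rintro ⟨hx, h⟩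
        rw [hl' x hx, hh' x hx] at h
        exact ⟨⟨hx, hsub x h⟩, by simpa [hP] using h⟩
    · intro x hx
      exact ⟨hl' x hx, hh' x hx⟩

/-! ### Prune and search -/

/-- Store a number in `realReg 5` that has a constant fraction of the pivots of the active points
on either side. The sample is taken from the first `4 ^ J` pivots, where `4 ^ J` is the largest
power of four that does not exceed the number of active points. -/
def choosePivot : Cmd :=
  let quadruple : NatExpr := .add (.add (.reg 6) (.reg 6)) (.add (.reg 6) (.reg 6))
  .block [
    .setNat 10 (.const 0),
    .setNat 6 (.const 1),
    .while (.not (.natLt (.reg 2) quadruple)) (.block [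
      .setNat 6 quadruple, .setNat 10 (.add (.reg 10) (.const 1))]),
    .setNat 12 (.const 0),
    .setNat 13 (.const 0),
    .call 0,
    .setReal 5 (.read 2 (.half (.half (.reg 11))))]

theorem countOn_mono (P : Set ℝ) (f : ℕ → ℝ) (i : ℕ) {k k' : ℕ} (h : k ≤ k') :
    countOn P f i k ≤ countOn P f i k' := by
  obtain ⟨d, rfl⟩ := Nat.exists_eq_add_of_le h
  rw [countOn_add]
  omega

theorem countOn_Iio_add_Ici (p : ℝ) (f : ℕ → ℝ) (i k : ℕ) :
    countOn (Set.Iio p) f i k + countOn (Set.Ici p) f i k = k := by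
  classical
  induction k with
  | zero => simp
  | succ k ih =>
    rw [countOn_succ, countOn_succ]
    by_cases h : f (i + k) < p
    · rw [if_pos (Set.mem_Iio.2 h), if_neg (show f (i + k) ∉ Set.Ici p from not_le.2 h)]
      omega
    · rw [if_neg (show f (i + k) ∉ Set.Iio p from h), if_pos (Set.mem_Ici.2 (not_lt.1 h))]
      omega

/-- The entry after the first quarter of the sample has at least a quarter of the pivots on either
side. -/
theorem SampleSpec.quarter {J : ℕ} {s s' : Store} (h : SampleSpec J s s') {p : ℝ}
    (hp : p = s'.realArr 2 (s.natReg 13 + 2 ^ J / 2 / 2)) :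
    4 ^ J ≤ 4 * countOn (Set.Iic p) (pivotAt s) (s.natReg 12) (4 ^ J) ∧
      4 ^ J ≤ 4 * countOn (Set.Ici p) (pivotAt s) (s.natReg 12) (4 ^ J) := by
  classical
  have e4 : 4 ^ J = 2 ^ J * 2 ^ J := by rw [← mul_pow]; rfl
  have hs := h.sorted
  obtain ⟨h₁, -⟩ := h.count _ (isLowerSet_Iic p)
  obtain ⟨-, h₂⟩ := h.count _ (isLowerSet_Iio p)
  have h₃ := countOn_Iio_add_Ici p (pivotAt s) (s.natReg 12) (4 ^ J)
  have hσ : 1 ≤ 2 ^ J := Nat.one_le_two_pow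
  generalize 2 ^ J = σ at *
  generalize hq : σ / 2 / 2 = q at *
  rw [e4] at h₁ h₂ h₃ ⊢
  constructor
  · have h₄ : countOn (Set.Iic p) (s'.realArr 2) (s.natReg 13) (q + 1) = q + 1 :=
      countOn_eq fun u hu => by
        rw [hp]
        exact hs u q (by omega) (by omega)
    have h₅ := countOn_mono (Set.Iic p) (s'.realArr 2) (s.natReg 13) (show q + 1 ≤ σ by omega)
    have h₆ := Nat.mul_le_mul_left σ (show σ ≤ 4 * countOn (Set.Iic p) (s'.realArr 2)
      (s.natReg 13) σ by omega)
    rw [Nat.mul_left_comm] at h₆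
    omega
  · obtain ⟨d, hd⟩ : ∃ d, σ = q + d := ⟨σ - q, by omega⟩
    have h₄ : countOn (Set.Iio p) (s'.realArr 2) (s.natReg 13) σ ≤ q := by
      have h₅ := countOn_le (Set.Iio p) (s'.realArr 2) (s.natReg 13) q
      have h₆ : countOn (Set.Iio p) (s'.realArr 2) (s.natReg 13 + q) d = 0 := by
        refine Finset.sum_eq_zero fun u hu => if_neg fun h' => ?_
        have := hs q (q + u) (by omega) (by have := Finset.mem_range.1 hu; omega)
        rw [← add_assoc] at this
        exact absurd (Set.mem_Iio.1 h') (not_lt.2 (hp ▸ this))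
      have h₇ := countOn_add (Set.Iio p) (s'.realArr 2) (s.natReg 13) q d
      rw [← hd] at h₇
      omega
    have h₅ := Nat.mul_le_mul_left σ (show 4 * countOn (Set.Iio p) (s'.realArr 2)
      (s.natReg 13) σ ≤ σ by omega)
    rw [Nat.mul_left_comm] at h₅
    omega

theorem wp_choosePivot {procs : List Cmd} (hp : procs.getD 0 .skip = sample) {n m : ℕ}
    {a b : ℕ → ℝ} (s : Store) (hs : Inv n m a b s) (hk : 0 < s.natReg 2) :
    Wp procs choosePivot s fun T s' => T ≤ 800 * s.natReg 2 + 100 ∧ Inv n m a b s' ∧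
      s'.natReg 2 = s.natReg 2 ∧ s'.natArr = s.natArr ∧
      s.natReg 2 ≤ 16 * countOn (Set.Iic (s'.realReg 5)) (pivotAt s) 0 (s.natReg 2) ∧
      s.natReg 2 ≤ 16 * countOn (Set.Ici (s'.realReg 5)) (pivotAt s) 0 (s.natReg 2) := by
  simp only [choosePivot, wp_block_cons, wp_block_one, wp_setNat]
  refine (wp_while (fun Φ s' => (∀ y < 6, s'.natReg y = s.natReg y) ∧ s'.realReg = s.realReg ∧
      s'.natArr = s.natArr ∧ s'.realArr = s.realArr ∧ s'.natReg 6 = 4 ^ s'.natReg 10 ∧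
      s'.natReg 6 ≤ s.natReg 2 ∧ Φ = 40 * (s.natReg 2 - s'.natReg 6))
      ?_ (40 * (s.natReg 2 - 1)) ?_).mono ?_
  · rintro _ s' ⟨h1, h2, h3, h4, h5, h6, rfl⟩ hp
    simp [h1] at hp
    have hpos : 0 < s'.natReg 6 := by rw [h5]; positivity
    simp only [wp_block_cons, wp_block_one, wp_setNat]
    refine ⟨_, ⟨?_, h2, h3, h4, ?_, ?_, rfl⟩, ?_⟩
    · intro y hy
      have h6 : y ≠ 6 := by omega
      have h10 : y ≠ 10 := by omega
      simp [h6, h10, h1 y hy]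
    · simp [pow_succ]
      omega
    · simpa using hp
    · simp
      omega
  · refine ⟨?_, rfl, rfl, rfl, ?_, ?_, ?_⟩
    · intro y hy
      have h6 : y ≠ 6 := by omega
      have h10 : y ≠ 10 := by omega
      simp [h6, h10]
    · simp
    · simpa using Nat.succ_le_of_lt hk
    · simp
  · rintro T s₁ ⟨hT, _, ⟨h1, h2, h3, h4, h5, h6, -⟩, hlt⟩
    simp [h1] at hlt
    rw [wp_call, hp]
    refine (wp_sample hp (s₁.natReg 10) _ (by simp)).mono ?_
    rintro T' s' ⟨hT', h⟩
    set s₂ := (s₁.setNat 12 (NatExpr.eval s₁ (.const 0))).setNat 13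
      (NatExpr.eval (s₁.setNat 12 (NatExpr.eval s₁ (.const 0))) (.const 0)) with hs₂
    have hreg : ∀ y < 6, s₂.natReg y = s.natReg y := by
      intro y hy
      have h12 : y ≠ 12 := by omega
      have h13 : y ≠ 13 := by omega
      simp [hs₂, h12, h13, h1 y hy]
    have hreg' : ∀ y < 6, s'.natReg y = s.natReg y := fun y hy =>
      (h.frame.natReg y (by omega)).trans (hreg y hy)
    have hna : s'.natArr = s.natArr := h.frame.natArr.trans h3
    have hra : ∀ y < 2, s'.realArr y = s.realArr y := fun y hy =>
      (h.frame.realArr y hy).trans (by simp [hs₂, h4])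
    have hrr : s'.realReg = s.realReg := h.frame.realReg.trans h2
    have hq := h.quarter rfl
    have hpv : pivotAt s₂ = pivotAt s := by
      funext u
      simp [pivotAt, hs₂, h3, h4]
    have h13 : s₂.natReg 13 = 0 := by simp [hs₂]
    have h12 : s₂.natReg 12 = 0 := by simp [hs₂]
    rw [hpv, h13, h12, Nat.zero_add] at hq
    have e5 : (RealExpr.read 2 (.half (.half (.reg 11)))).eval s' =
        s'.realArr 2 (2 ^ s₁.natReg 10 / 2 / 2) := by
      simp [h.size]
    rw [wp_setReal, e5]
    have hm₁ := countOn_mono (Set.Iic (s'.realArr 2 (2 ^ s₁.natReg 10 / 2 / 2))) (pivotAt s) 0 h6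
    have hm₂ := countOn_mono (Set.Ici (s'.realArr 2 (2 ^ s₁.natReg 10 / 2 / 2))) (pivotAt s) 0 h6
    rw [← h5] at hq hT'
    refine ⟨?_, ⟨⟨?_, ?_, ?_, ?_⟩, ?_, ?_⟩, ?_, ?_, ?_, ?_⟩
    · simp at hT ⊢
      omega
    · simp [hreg', hs.env.n_eq]
    · simp [hreg', hs.env.m_eq]
    · simp [hra, hs.env.a_eq]
    · simp [hra, hs.env.b_eq]
    · simpa [hna, hrr] using hs.bracket
    · simpa [hna, actives, hreg'] using hs.active
    · simp [hreg']
    · simp [hna]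
    · simp
      omega
    · simp
      omega

/-- One round of prune and search. -/
def round : Cmd :=
  .block [
    choosePivot,
    .ite (.and (.realLt (.reg 2) (.reg 5)) (.realLt (.reg 5) (.reg 3))) evaluate .skip,
    update]

open Classical in
/-- Every active point whose pivot is outside of the bracket lowers the potential. -/
theorem potential_shrink (m : ℕ) (a b : ℕ → ℝ) (lo hi : ℕ → ℕ) (tl th : ℝ) (P : Set ℝ)
    (hP : ∀ v ∈ P, v ≤ tl ∨ th ≤ v) :
    potential m (newLo a b lo hi tl) (newHi a b lo hi tl th) +
      ∑ x ∈ (Finset.range m).filter (fun x => lo x < hi x),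
        (if pivot a b lo hi x ∈ P then 1 else 0) ≤ potential m lo hi := by
  rw [Finset.sum_filter, potential, potential, ← Finset.sum_add_distrib]
  refine Finset.sum_le_sum fun x _ => ?_
  split_ifs with h₁ h₂
  · exact size_shrink h₁ (hP _ h₂)
  · exact size_shrink_le x
  · exact size_shrink_le x

theorem potential_congr {m : ℕ} {lo hi lo' hi' : ℕ → ℕ} (h : ∀ x < m, lo' x = lo x ∧ hi' x = hi x) :
    potential m lo' hi' = potential m lo hi := by
  refine Finset.sum_congr rfl fun x hx => ?_
  obtain ⟨h₁, h₂⟩ := h x (Finset.mem_range.1 hx)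
  rw [h₁, h₂]

theorem wp_round {procs : List Cmd} (hp : procs.getD 0 .skip = sample) {n m : ℕ}
    {a b : ℕ → ℝ} (hn : 0 < n) (ha : StrictMonoOn a (Set.Iio n)) (s : Store)
    (hs : Inv n m a b s) (hk : 0 < s.natReg 2) :
    Wp procs round s fun T s' => T + 10 ≤ 2000 * (s.natReg 2 * Nat.size n) ∧ Inv n m a b s' ∧
      s.natReg 2 + 16 * potential m (s'.natArr 0) (s'.natArr 1) ≤
        16 * potential m (s.natArr 0) (s.natArr 1) := by
  classical
  simp only [round, wp_block_cons, wp_block_one]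
  refine (wp_choosePivot hp s hs hk).mono ?_
  rintro T₁ s₁ ⟨hT₁, hs₁, hk₁, hna₁, hlow, hhigh⟩
  have hL : 1 ≤ Nat.size n := Nat.size_pos.2 hn
  have hkL : s.natReg 2 ≤ s.natReg 2 * Nat.size n := Nat.le_mul_of_pos_right _ hL
  have hcount : ∀ P : Set ℝ, countOn P (pivotAt s) 0 (s.natReg 2) =
      ∑ x ∈ (Finset.range m).filter (fun x => s.natArr 0 x < s.natArr 1 x),
        (if pivot a b (s.natArr 0) (s.natArr 1) x ∈ P then 1 else 0) := by
    intro P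
    rw [← hs.active.sum_eq, actives, List.map_map, sum_map_range, countOn]
    refine Finset.sum_congr rfl fun u _ => ?_
    have e : pivotAt s (0 + u) = pivot a b (s.natArr 0) (s.natArr 1) (s.natArr 2 u) := by
      rw [← hs.env.a_eq, ← hs.env.b_eq, Nat.zero_add]
      rfl
    rw [e]
    rfl
  have finish : ∀ (T₂ : ℕ) (s₂ : Store), T₂ ≤ s.natReg 2 * (40 * Nat.size n + 90) + 90 →
      Inv n m a b s₂ → s₂.natReg 2 = s.natReg 2 → s₂.natArr = s.natArr →
      s₂.realReg 5 = s₁.realReg 5 →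
      (s₂.realReg 5 ≤ s₂.realReg 2 ∨ s₂.realReg 3 ≤ s₂.realReg 5) →
      Wp procs update s₂ fun T₃ s' =>
        T₁ + ((Test.and (.realLt (.reg 2) (.reg 5)) (.realLt (.reg 5) (.reg 3))).cost + 1 + T₂ +
          T₃) + 10 ≤ 2000 * (s.natReg 2 * Nat.size n) ∧ Inv n m a b s' ∧
        s.natReg 2 + 16 * potential m (s'.natArr 0) (s'.natArr 1) ≤
          16 * potential m (s.natArr 0) (s.natArr 1) := by
    intro T₂ s₂ hT₂ hs₂ hk₂ hna₂ h5 hor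
    refine (wp_update procs ha s₂ hs₂).mono ?_
    rintro T₃ s₃ ⟨hT₃, hs₃, hnew⟩
    refine ⟨?_, hs₃, ?_⟩
    · rw [Nat.mul_add, Nat.mul_left_comm] at hT₂
      simp
      omega
    · rw [potential_congr hnew, hna₂]
      rcases hor with h | h
      · have h₁ := potential_shrink m a b (s.natArr 0) (s.natArr 1) (s₂.realReg 2) (s₂.realReg 3)
          (Set.Iic (s₁.realReg 5)) (fun v hv => .inl ((Set.mem_Iic.1 hv).trans (h5 ▸ h)))
        rw [← hcount] at h₁
        omega
      · have h₁ := potential_shrink m a b (s.natArr 0) (s.natArr 1) (s₂.realReg 2) (s₂.realReg 3)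
          (Set.Ici (s₁.realReg 5)) (fun v hv => .inr ((h5 ▸ h).trans (Set.mem_Ici.1 hv)))
        rw [← hcount] at h₁
        omega
  rw [wp_ite]
  constructor
  · intro h
    simp only [Test.Holds, RealExpr.eval] at h
    refine (wp_evaluate procs hn ha s₁ hs₁ h.1 h.2).mono ?_
    rintro T₂ s₂ ⟨hT₂, hs₂, hk₂, hna₂, h5, hor⟩
    exact finish T₂ s₂ (by rwa [hk₁] at hT₂) hs₂ (hk₂.trans hk₁) (hna₂.trans hna₁) h5 hor
  · intro h
    simp only [Test.Holds, RealExpr.eval, not_and_or, not_lt] at h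
    rw [wp_skip]
    exact finish 1 s₁ (by omega) hs₁ hk₁ hna₁ rfl h

/-! ### The whole program -/

/-- The initial ranges of cells, list of active points, and bracket. -/
def setup : Cmd :=
  .block [
    .setReal 3 (.const 1),
    .setNat 3 (.const 0),
    .setNat 6 (.const 0),
    .while (.natLt (.reg 3) (.reg 1)) (.block [
      .setNat 4 (.reg 3),
      .writeNat 0 (.reg 4) (.const 0),
      .writeNat 1 (.reg 4) (.sub (.reg 0) (.const 1)),
      .setReal 7 (.sub (.read 0 (.const 0)) (.read 1 (.reg 4))),
      .ite (.realLt (.reg 7) (.reg 2)) (.setReal 2 (.reg 7)) .skip,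
      .setReal 7 (.add (.sub (.read 0 (.sub (.reg 0) (.const 1))) (.read 1 (.reg 4))) (.const 1)),
      .ite (.realLt (.reg 3) (.reg 7)) (.setReal 3 (.reg 7)) .skip,
      push,
      .setNat 3 (.add (.reg 3) (.const 1))]),
    .setNat 2 (.reg 6)]

theorem wp_setup (procs : List Cmd) {n m : ℕ} {a b : ℕ → ℝ} (hn : 0 < n)
    (ha : StrictMonoOn a (Set.Iio n)) (s : Store) (hs : Env n m a b s) (h2 : s.realReg 2 = 0)
    (h4 : s.realReg 4 = 0) :
    Wp procs setup s fun T s' => T ≤ m * 120 + 20 ∧ Inv n m a b s' ∧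
      potential m (s'.natArr 0) (s'.natArr 1) ≤ m * Nat.size n := by
  simp only [setup, wp_block_cons, wp_block_one, wp_setNat, wp_setReal]
  set P : ℕ → Bool := fun _ => decide (0 < n - 1) with hP
  set f : ℕ → ℝ := fun x => b x - a 0 with hf
  refine (wp_for (fun j s' => Env n m a b s' ∧ s'.natReg 3 = j ∧
      s'.realReg 2 ≤ 0 ∧ 1 ≤ s'.realReg 3 ∧ (∀ x < j, s'.realReg 2 ≤ a 0 - b x) ∧
      (∀ x < j, a (n - 1) - b x + 1 ≤ s'.realReg 3) ∧
      (∀ x < j, s'.natArr 0 x = 0) ∧ (∀ x < j, s'.natArr 1 x = n - 1) ∧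
      (List.range (s'.natReg 6)).map (s'.natArr 2) = (List.range j).filter P ∧
      s'.realReg 4 = 0 + (((List.range j).filter fun x => !P x).map f).sum)
      m 110 ?_ ?_ ?_).mono ?_
  · rintro j s' ⟨henv, h3, -⟩
    simp [henv.m_eq, h3]
  · rintro j s' hj ⟨henv, h3, r2, r3, hlo, hhi, hl, hh, hlist, hsum⟩
    simp only [wp_block_cons, wp_block_one, wp_setNat, wp_setReal, wp_writeNat]
    -- The two adjustments of the bracket, in the form of `min` and `max`.
    have hmin : ∀ (s : Store) (Q : ℕ → Store → Prop),
        (∀ T ≤ 10, ∀ s' : Store, s'.natReg = s.natReg → s'.natArr = s.natArr →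
          s'.realArr = s.realArr → (∀ y ≠ 2, s'.realReg y = s.realReg y) →
          s'.realReg 2 = min (s.realReg 2) (s.realReg 7) → Q T s') →
        Wp procs (.ite (.realLt (.reg 7) (.reg 2)) (.setReal 2 (.reg 7)) .skip) s Q := by
      intro s Q hQ
      rw [wp_ite, wp_setReal, wp_skip]
      constructor
      · intro h
        simp only [Test.Holds, RealExpr.eval] at h
        refine hQ _ (by simp) _ rfl rfl rfl (fun y hy => by simp [hy]) ?_
        simp [min_eq_right h.le]
      · intro h
        simp only [Test.Holds, RealExpr.eval, not_lt] at h
        exact hQ _ (by simp) _ rfl rfl rfl (fun y hy => rfl) (min_eq_left h).symm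
    have hmax : ∀ (s : Store) (Q : ℕ → Store → Prop),
        (∀ T ≤ 10, ∀ s' : Store, s'.natReg = s.natReg → s'.natArr = s.natArr →
          s'.realArr = s.realArr → (∀ y ≠ 3, s'.realReg y = s.realReg y) →
          s'.realReg 3 = max (s.realReg 3) (s.realReg 7) → Q T s') →
        Wp procs (.ite (.realLt (.reg 3) (.reg 7)) (.setReal 3 (.reg 7)) .skip) s Q := by
      intro s Q hQ
      rw [wp_ite, wp_setReal, wp_skip]
      constructor
      · intro h
        simp only [Test.Holds, RealExpr.eval] at h
        refine hQ _ (by simp) _ rfl rfl rfl (fun y hy => by simp [hy]) ?_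
        simp [max_eq_right h.le]
      · intro h
        simp only [Test.Holds, RealExpr.eval, not_lt] at h
        exact hQ _ (by simp) _ rfl rfl rfl (fun y hy => rfl) (max_eq_left h).symm
    refine hmin _ _ fun T₁ hT₁ s₁ k1 k2 k3 k4 k5 => hmax _ _ fun T₂ hT₂ s₂ l1 l2 l3 l4 l5 => ?_
    simp [h3] at k1 k2 k3 k4 k5
    simp [k1, k3] at l1 l2 l3 l4 l5
    refine (wp_push procs s₂).mono ?_
    rintro T₃ s₃ ⟨hT₃, h⟩
    have e4 : s₂.natReg 4 = j := by simp [l1]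
    have e40 : s₂.natArr 0 j = 0 := by simp [l2, k2]
    have e41 : s₂.natArr 1 j = n - 1 := by simp [l2, k2, henv.n_eq]
    have e2 : s₃.realReg 2 = min (s'.realReg 2) (a 0 - b j) := by
      simp [h.realReg, l4, k5, henv.a_eq, henv.b_eq]
    have e3 : s₃.realReg 3 = max (s'.realReg 3) (a (n - 1) - b j + 1) := by
      simp [h.realReg, l5, k4, henv.a_eq, henv.b_eq, henv.n_eq]
    have hPx : P (s₂.natReg 4) =
        decide (s₂.natArr 0 (s₂.natReg 4) < s₂.natArr 1 (s₂.natReg 4)) := by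
      rw [e4, e40, e41]
    refine ⟨?_, ⟨?_, ?_, ?_, ?_⟩, ?_, ?_, ?_, ?_, ?_, ?_, ?_, ?_, ?_⟩
    · simp
      omega
    · simp [h.natReg, l1, henv.n_eq]
    · simp [h.natReg, l1, henv.m_eq]
    · simp [h.realArr, l3, henv.a_eq]
    · simp [h.realArr, l3, henv.b_eq]
    · simp [h.natReg, l1, h3]
    · simp [e2, r2]
    · simp [e3, r3]
    · intro x hx
      simp only [realReg_setNat, e2]
      rcases Nat.lt_succ_iff_lt_or_eq.1 hx with hx | rfl
      · exact (min_le_left _ _).trans (hlo x hx)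
      · exact min_le_right _ _
    · intro x hx
      simp only [realReg_setNat, e3]
      rcases Nat.lt_succ_iff_lt_or_eq.1 hx with hx | rfl
      · exact (hhi x hx).trans (le_max_left _ _)
      · exact le_max_right _ _
    · intro x hx
      rcases Nat.lt_succ_iff_lt_or_eq.1 hx with hx | rfl
      · simp [h.lo, l2, k2, hx.ne, hl x hx]
      · simp [h.lo, e40]
    · intro x hx
      rcases Nat.lt_succ_iff_lt_or_eq.1 hx with hx | rfl
      · simp [h.hi, l2, k2, hx.ne, hh x hx]
      · simp [h.hi, e41]
    · have := h.list (List.range j) P hPx (by simpa [l1, l2, k2] using hlist)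
      rw [e4, ← List.range_succ] at this
      simpa using this
    · have := h.sum 0 f (List.range j) P hPx
        (by rw [e4, e40, l3, henv.a_eq, henv.b_eq]) (by simpa [l4, k4] using hsum)
      rw [e4, ← List.range_succ] at this
      simpa using this
  · refine ⟨⟨?_, ?_, ?_, ?_⟩, ?_⟩
    · simp [hs.n_eq]
    · simp [hs.m_eq]
    · simp [hs.a_eq]
    · simp [hs.b_eq]
    · simp [h2, h4]
  · rintro T s' ⟨hT, henv, h3, r2, r3, hlo, hhi, hl, hh, hlist, hsum⟩
    have ha0 : ∀ x, a 0 ≤ a (cell n a x) := fun x =>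
      ha.monotoneOn (Set.mem_Iio.2 hn) (Set.mem_Iio.2 (cell_lt hn)) (Nat.zero_le _)
    have han : ∀ x, a (cell n a x) ≤ a (n - 1) := fun x =>
      ha.monotoneOn (Set.mem_Iio.2 (cell_lt hn)) (Set.mem_Iio.2 (by omega))
        (by have := cell_lt (a := a) (x := x) hn; omega)
    refine ⟨?_, ⟨⟨?_, ?_, ?_, ?_⟩, ⟨?_, ?_, ?_, ?_, ?_, ?_, ?_, ?_⟩, ⟨?_, ?_⟩⟩, ?_⟩
    · simp at hT ⊢
      omega
    · simp [henv.n_eq]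
    · simp [henv.m_eq]
    · simp [henv.a_eq]
    · simp [henv.b_eq]
    · intro x hx
      simp [hl x hx]
    · intro x hx
      simp [hh x hx, hn]
    · intro x hx i hi
      simp [hl x hx] at hi
    · intro x hx hi
      simp [hh x hx] at hi
      omega
    · simp only [realReg_setNat]
      linarith
    · refine Finset.sum_nonpos fun x hx => ?_
      have h₁ := hlo x (Finset.mem_range.1 hx)
      have h₂ := ha0 (b x + s'.realReg 2)
      simp only [realReg_setNat]
      linarith
    · intro hm
      refine Finset.sum_pos (fun x hx => ?_) ⟨0, Finset.mem_range.2 hm⟩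
      have h₁ := hhi x (Finset.mem_range.1 hx)
      have h₂ := han (b x + s'.realReg 3)
      simp only [realReg_setNat]
      linarith
    · change s'.realReg 4 = ∑ x ∈ (Finset.range m).filter
        (fun x => ¬ s'.natArr 0 x < s'.natArr 1 x), (b x - a (s'.natArr 0 x))
      rw [hsum, zero_add, ← List.sum_toFinset f (List.nodup_range.filter _)]
      refine Finset.sum_congr ?_ fun x hx => ?_
      · ext x
        rw [List.mem_toFinset, List.mem_filter, List.mem_range, Finset.mem_filter,
          Finset.mem_range]
        refine and_congr_right fun hx => ?_
        rw [hl x hx, hh x hx]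
        simp [hP]
      · have hx := Finset.mem_range.1 (Finset.mem_filter.1 hx).1
        simp [hf, hl x hx]
    · simp only [actives, natArr_setNat, natReg_setNat, if_true, NatExpr.eval]
      rw [hlist]
      exact List.nodup_range.filter _
    · intro x
      simp only [actives, natArr_setNat, natReg_setNat, if_true, NatExpr.eval]
      rw [hlist, List.mem_filter, List.mem_range]
      refine and_congr_right fun hx => ?_
      rw [hl x hx, hh x hx]
      simp [hP]
    · have hle : ∀ x ∈ Finset.range m, Nat.size (s'.natArr 1 x - s'.natArr 0 x) ≤ Nat.size n := by
        intro x hx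
        have hx := Finset.mem_range.1 hx
        rw [hl x hx, hh x hx]
        exact Nat.size_le_size (by omega)
      simpa [potential] using Finset.sum_le_sum hle

/-- The stationary point of the quadratic function that is left, and its value. -/
def output : Cmd :=
  .block [
    .setReal 0 (.div (.sub (.const 0) (.reg 4)) (.ofNat (.reg 1))),
    .setReal 1 (.const 0),
    .setNat 3 (.const 0),
    .while (.natLt (.reg 3) (.reg 1)) (.block [
      .setReal 7 (.sub (.add (.read 1 (.reg 3)) (.reg 0)) (.read 0 (.read 0 (.reg 3)))),
      .setReal 1 (.add (.reg 1) (.mul (.reg 7) (.reg 7))),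
      .setNat 3 (.add (.reg 3) (.const 1))])]

theorem wp_output (procs : List Cmd) {n m : ℕ} {a b : ℕ → ℝ} (s : Store) (hs : Env n m a b s) :
    Wp procs output s fun T s' => T ≤ m * 50 + 30 ∧ s'.realReg 0 = (0 - s.realReg 4) / m ∧
      s'.realReg 1 = assignedRMS m a b (s.natArr 0) ((0 - s.realReg 4) / m) := by
  simp only [output, wp_block_cons, wp_block_one, wp_setNat, wp_setReal]
  refine (wp_for (fun j s' => Env n m a b s' ∧ s'.natReg 3 = j ∧ s'.natArr = s.natArr ∧
      s'.realReg 0 = (0 - s.realReg 4) / m ∧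
      s'.realReg 1 = assignedRMS j a b (s.natArr 0) ((0 - s.realReg 4) / m)) m 40 ?_ ?_ ?_).mono ?_
  · rintro j s' ⟨henv, h3, -⟩
    simp [henv.m_eq, h3]
  · rintro j s' hj ⟨henv, h3, hna, h0, h1⟩
    simp only [wp_block_cons, wp_block_one, wp_setNat, wp_setReal]
    refine ⟨by simp, ⟨?_, ?_, ?_, ?_⟩, ?_, ?_, ?_, ?_⟩
    · simp [henv.n_eq]
    · simp [henv.m_eq]
    · simp [henv.a_eq]
    · simp [henv.b_eq]
    · simp [h3]
    · simp [hna]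
    · simp [h0]
    · rw [assignedRMS, Finset.sum_range_succ, ← assignedRMS]
      simp [h1, h3, henv.a_eq, henv.b_eq, hna, h0, sq]
  · refine ⟨⟨?_, ?_, ?_, ?_⟩, ?_, ?_, ?_, ?_⟩
    · simp [hs.n_eq]
    · simp [hs.m_eq]
    · simp [hs.a_eq]
    · simp [hs.b_eq]
    · simp
    · simp
    · simp [hs.m_eq]
    · simp [assignedRMS]
  · rintro T s' ⟨hT, henv, h3, hna, h0, h1⟩
    refine ⟨?_, h0, h1⟩
    simp at hT ⊢
    omega

/-- The program that finds a local minimum of the RMS distance under translation. -/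
def localMinProgram : Program where
  procs := [sample]
  main := .block [setup, .while (.natLt (.const 0) (.reg 2)) round, output]

theorem localMinProgram_spec {n m : ℕ} {a b : ℕ → ℝ} (hn : 0 < n)
    (ha : StrictMonoOn a (Set.Iio n)) (s : Store) (hs : Env n m a b s) (h2 : s.realReg 2 = 0)
    (h4 : s.realReg 4 = 0) :
    ∃ T s', localMinProgram.Runs s T s' ∧
      T ≤ 40000 * (m * Nat.size n * Nat.size n) + 60 ∧
      IsLocalMin (fun t => assignedRMS m a b (fun x => cell n a (b x + t)) t) (s'.realReg 0) ∧
      s'.realReg 1 = assignedRMS m a b (fun x => cell n a (b x + s'.realReg 0)) (s'.realReg 0) := by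
  suffices h : Wp localMinProgram.procs localMinProgram.main s fun T s' =>
      T ≤ 40000 * (m * Nat.size n * Nat.size n) + 60 ∧
      IsLocalMin (fun t => assignedRMS m a b (fun x => cell n a (b x + t)) t) (s'.realReg 0) ∧
      s'.realReg 1 = assignedRMS m a b (fun x => cell n a (b x + s'.realReg 0)) (s'.realReg 0) from h
  simp only [localMinProgram, wp_block_cons, wp_block_one]
  have hL : 1 ≤ Nat.size n := Nat.size_pos.2 hn
  refine (wp_setup _ hn ha s hs h2 h4).mono ?_
  rintro T₁ s₁ ⟨hT₁, hs₁, hΦ⟩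
  refine (wp_while (fun Φ s => Inv n m a b s ∧
    Φ = 32000 * (Nat.size n * potential m (s.natArr 0) (s.natArr 1))) ?_ _ ⟨hs₁, rfl⟩).mono ?_
  · rintro _ s ⟨hs, rfl⟩ hp
    simp only [Test.Holds, NatExpr.eval] at hp
    refine (wp_round rfl hn ha s hs hp).mono ?_
    rintro T s' ⟨hT, hs', hle⟩
    refine ⟨_, ⟨hs', rfl⟩, ?_⟩
    have := Nat.mul_le_mul_left (Nat.size n) hle
    rw [Nat.mul_add, Nat.mul_left_comm, Nat.mul_left_comm _ 16, Nat.mul_comm _ (s.natReg 2)] at this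
    simp
    omega
  · rintro T₂ s₂ ⟨hT₂, _, ⟨hs₂, -⟩, hp⟩
    simp only [Test.Holds, NatExpr.eval, not_lt, nonpos_iff_eq_zero] at hp
    refine (wp_output _ s₂ hs₂.env).mono ?_
    rintro T₃ s₃ ⟨hT₃, h0, h1⟩
    have hact : ∀ x < m, ¬ s₂.natArr 0 x < s₂.natArr 1 x := by
      intro x hx h
      have := (hs₂.active.mem_iff x).2 ⟨hx, h⟩
      simp [actives, hp] at this
    obtain ⟨hmin, hval⟩ := hs₂.bracket.isLocalMin ha hact
    refine ⟨?_, ?_, ?_⟩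
    · have e₁ := Nat.mul_le_mul_left (Nat.size n) hΦ
      have e₂ : m ≤ m * Nat.size n * Nat.size n := by
        rw [mul_assoc]
        exact Nat.le_mul_of_pos_right _ (Nat.mul_pos hL hL)
      rw [Nat.mul_comm (Nat.size n) (m * Nat.size n)] at e₁
      simp at hT₂
      omega
    · rw [h0]
      exact hmin
    · rw [h1, h0]
      exact hval

end RealRAM

/-! ### The time bound -/

theorem one_le_lg (x : ℕ) : 1 ≤ lg x := le_max_left _ _

theorem natSize_le_lg {n : ℕ} (hn : 0 < n) : (Nat.size n : ℝ) ≤ 2 * lg n := by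
  obtain ⟨k, hk⟩ : ∃ k, n.size = k + 1 := ⟨n.size - 1, by have := Nat.size_pos.2 hn; omega⟩
  have h : 2 ^ k ≤ n := Nat.lt_size.1 (by omega)
  have h₁ : (k : ℝ) ≤ lg n := by
    refine le_trans ?_ (le_max_right _ _)
    rw [Real.le_logb_iff_rpow_le (by norm_num) (by exact_mod_cast hn), Real.rpow_natCast]
    exact_mod_cast h
  rw [hk]
  push_cast
  have := one_le_lg n
  linarith

/-- For `m < n`, the second time bound is large enough either because of its first term or because
`lg m` and `lg n` are of the same order, according to whether `m` exceeds the square root of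
`n`. -/
theorem mul_lg_le {n m : ℕ} (hn : 0 < n) :
    (m : ℝ) * lg n ≤ 4 * (n + m * lg m) := by
  have hn' : (0 : ℝ) < n := by exact_mod_cast hn
  have hm' : (0 : ℝ) ≤ m := Nat.cast_nonneg _
  have h1 := one_le_lg m
  by_cases h : (n : ℝ) ≤ m ^ 2
  · have hm : (0 : ℝ) < m := by
      rcases hm'.lt_or_eq with h' | h'
      · exact h'
      · rw [← h'] at h
        norm_num at h
        linarith
    have h₁ : lg n ≤ 2 * lg m := by
      refine max_le (by linarith) ?_
      calc Real.logb 2 n ≤ Real.logb 2 ((m : ℝ) ^ 2) :=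
            Real.logb_le_logb_of_le (by norm_num) hn' h
        _ = 2 * Real.logb 2 m := by rw [Real.logb_pow]; norm_num
        _ ≤ 2 * lg m := by
          have : Real.logb 2 m ≤ lg m := le_max_right _ _
          linarith
    nlinarith
  · push Not at h
    set r := Real.sqrt n with hr
    have hr0 : 0 < r := Real.sqrt_pos.2 hn'
    have hrr : r * r = n := Real.mul_self_sqrt hn'.le
    have hmr : (m : ℝ) ≤ r := Real.le_sqrt_of_sq_le h.le
    have hr1 : 1 ≤ r := Real.one_le_sqrt.2 (by exact_mod_cast hn)
    have h₁ : lg n ≤ 4 * r := by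
      refine max_le (by linarith) ?_
      have h₂ : Real.log n = 2 * Real.log r := by
        rw [← hrr, Real.log_mul hr0.ne' hr0.ne']
        ring
      have h₃ : Real.log r ≤ r := (Real.log_le_sub_one_of_pos hr0).trans (by linarith)
      have h₄ : (1 : ℝ) / 2 ≤ Real.log 2 := by
        have := Real.log_two_gt_d9
        linarith
      rw [Real.logb, h₂, div_le_iff₀ (by linarith)]
      nlinarith
    have h₅ : (m : ℝ) * lg n ≤ r * (4 * r) :=
      mul_le_mul hmr h₁ (by linarith [one_le_lg n]) hr0.le
    nlinarith

/-- The time `m lg² n` is within both time bounds, up to a constant factor. -/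
theorem lg_sq_le_min {n m : ℕ} (hn : 0 < n) :
    1 + (m : ℝ) * lg n ^ 2 ≤ 8 * min ((n : ℝ) + m * lg n ^ 2 * lg m)
      ((n : ℝ) * lg n + m * lg n * lg (min n m)) := by
  have hn' : (1 : ℝ) ≤ n := by exact_mod_cast hn
  have hm' : (0 : ℝ) ≤ m := Nat.cast_nonneg _
  have h₁ := one_le_lg n
  have h₂ := one_le_lg m
  have h₃ : 0 ≤ (m : ℝ) * lg n ^ 2 := by positivity
  rw [mul_min_of_nonneg _ _ (by norm_num)]
  refine le_min ?_ ?_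
  · have : (m : ℝ) * lg n ^ 2 ≤ m * lg n ^ 2 * lg m := le_mul_of_one_le_right h₃ h₂
    linarith
  · have h₄ : 1 ≤ (n : ℝ) * lg n := by nlinarith
    rcases le_total n m with h | h
    · rw [min_eq_left h]
      nlinarith
    · rw [min_eq_right h]
      have := mul_le_mul_of_nonneg_right (mul_lg_le (m := m) hn) (by linarith : 0 ≤ lg n)
      nlinarith

theorem theorem5p1 :
    ∃ (P : RealRAM.Program) (C : ℝ),
      ∀ (n m : ℕ) (a : Fin n → ℝ) (b : Fin m → ℝ),
        0 < n → StrictMono a → Function.Injective b →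
        ∃ (T : ℕ) (s : RealRAM.Store),
          P.Runs (RealRAM.input a b) T s ∧
          IsLocalMin (rmsUnderTranslation (Finset.univ.image b) (Finset.univ.image a))
            (s.realReg 0) ∧
          s.realReg 1 =
            rmsUnderTranslation (Finset.univ.image b) (Finset.univ.image a) (s.realReg 0) ∧
          (T : ℝ) ≤ C * min
            ((n : ℝ) + m * lg n ^ 2 * lg m)
            ((n : ℝ) * lg n + m * lg n * lg (min n m)) := by
  refine ⟨RealRAM.localMinProgram, 160000 * 8, fun n m a b hn ha hb => ?_⟩
  set s := RealRAM.input a b with hs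
  have ha' : ∀ i : Fin n, s.realArr 0 i = a i := fun i => by simp [hs, RealRAM.input]
  have hb' : ∀ i : Fin m, s.realArr 1 i = b i := fun i => by simp [hs, RealRAM.input]
  have hmono : StrictMonoOn (s.realArr 0) (Set.Iio n) := by
    intro i hi j hj hij
    have := ha (show (⟨i, hi⟩ : Fin n) < ⟨j, hj⟩ from hij)
    rwa [← ha', ← ha'] at this
  obtain ⟨T, s', hrun, hT, hmin, hval⟩ := RealRAM.localMinProgram_spec (n := n) (m := m) hn hmono s
    ⟨rfl, rfl, rfl, rfl⟩ rfl rfl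
  have hr : rmsUnderTranslation (Finset.univ.image b) (Finset.univ.image a) = fun t =>
      RealRAM.assignedRMS m (s.realArr 0) (s.realArr 1)
        (fun x => RealRAM.cell n (s.realArr 0) (s.realArr 1 x + t)) t :=
    funext fun t => RealRAM.rmsUnderTranslation_eq a b _ _ ha' hb' hn hmono hb t
  refine ⟨T, s', hrun, by rw [hr]; exact hmin, by rw [hr]; exact hval, ?_⟩
  have h₁ : (T : ℝ) ≤ 40000 * (m * Nat.size n * Nat.size n) + 60 := by exact_mod_cast hT
  have h₂ := natSize_le_lg hn
  have h₃ : (Nat.size n : ℝ) * Nat.size n ≤ (2 * lg n) * (2 * lg n) :=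
    mul_le_mul h₂ h₂ (Nat.cast_nonneg _) (by linarith [one_le_lg n])
  have h₄ := mul_le_mul_of_nonneg_left h₃ (Nat.cast_nonneg (α := ℝ) m)
  have h₅ := lg_sq_le_min (m := m) hn
  rw [mul_assoc]
  refine le_trans ?_ (mul_le_mul_of_nonneg_left h₅ (by norm_num))
  rw [mul_assoc] at h₁
  nlinarith
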